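/- **Theorem (Explicit Noether normalization for affine algebras).** Let $\mathbb{F}$ be a field with algebraic closure $\overline{\mathbb{F}}$, let $n,d\ge 1$ and $1\le m,k\le n$ be integers, and let $d_1,\dots,d_n$ be pairwise coprime integers greater than $d$. Let $M=(c_{i,j})\in\mathbb{F}^{m\times n}$ be a $k$-regular matrix, i.e., any $k$ distinct columns of $M$ are linearly independent, and put \[ f_i=\sum_{j=1}^n c_{i,j}X_j^{d_j}\in\mathbb{F}[X_1,\dots,X_n]\qquad(1\le i\le m). \] Let $A$ be a commutative $\mathbb{F}$-algebra generated by $a_1,\dots,a_n\in A$, of Krull dimension at most $k$. Let $I\subseteq\mathbb{F}[X_1,\dots,X_n]$ be the ideal of all polynomial relations satisfied by $a=(a_1,\dots,a_n)$, and suppose that the affine variety $V(I)\subseteq\overline{\mathbb{F}}^n$ has degree at most $d$. Here the degree of an irreducible affine variety $V\subseteq\overline{\mathbb{F}}^n$ over $\overline{\mathbb{F}}$ is the number of points in which it meets an affine subspace of codimension $\dim V$ in general position, and the degree of an affine variety is the sum of the degrees of its irreducible components over $\overline{\mathbb{F}}$. Then: 1. $A$ is a finitely generated module over its subring $S=\mathbb{F}[f_1(a),\dots,f_m(a)]$.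 2. If, moreover, the Krull dimension of $A$ equals $k$ and $k=m$, then $f_1(a),\dots,f_m(a)$ are algebraically independent over $\mathbb{F}$, and hence $S$ is isomorphic, as an $\mathbb{F}$-algebra, to the polynomial ring $\mathbb{F}[Y_1,\dots,Y_m]$ via $f_i(a)\mapsto Y_i$. -/

import Mathlib

noncomputable section

namespace NoetherNorm

open MvPolynomial

section Variety

variable {K : Type*} [Field K] {n : ℕ}

/-- `V ⊆ Kⁿ` is the set of common zeros of an ideal of `K[X₁, …, Xₙ]`. For an algebraically closed
field `K`, these are the affine varieties in affine `n`-space over `K`. -/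
def IsAffineVariety (V : Set (Fin n → K)) : Prop :=
  ∃ I : Ideal (MvPolynomial (Fin n) K), V = zeroLocus K I

/-- An affine variety is irreducible if it is nonempty and is not the union of two proper affine
subvarieties. -/
def IsIrreducibleVariety (V : Set (Fin n → K)) : Prop :=
  IsAffineVariety V ∧ V.Nonempty ∧
    ∀ V₁ V₂ : Set (Fin n → K), IsAffineVariety V₁ → IsAffineVariety V₂ →
      V = V₁ ∪ V₂ → V₁ = V ∨ V₂ = V

/-- The irreducible components: the maximal irreducible subvarieties. -/
def components (V : Set (Fin n → K)) : Set (Set (Fin n → K)) :=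
  {W | Maximal (fun Z => IsIrreducibleVariety Z ∧ Z ⊆ V) W}

/-- The dimension of `V`: the supremum of the lengths `r` of chains `V₀ ⊊ V₁ ⊊ ⋯ ⊊ Vᵣ` of
irreducible subvarieties of `V`. -/
def dimension (V : Set (Fin n → K)) : WithBot ℕ∞ :=
  Order.krullDim {W : Set (Fin n → K) // IsIrreducibleVariety W ∧ W ⊆ V}

/-- The solution set of the linear system `C x = b`. For `C` of rank `r` this is an affine subspace
of codimension `r`, and every affine subspace of codimension `r` arises in this way. -/
def linearSection {r : ℕ} (C : Matrix (Fin r) (Fin n) K) (b : Fin r → K) : Set (Fin n → K) :=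
  {x | C.mulVec x = b}

/-- `δ` is the number of points of `V ∩ L` for affine subspaces `L` of codimension `r` in general
position: there is a nonzero polynomial `G` in the coefficients of a system of `r` affine linear
equations such that `V ∩ L` has `δ` points for the solution set `L` of every system at which `G`
does not vanish. (Over an infinite field there is at most one such `δ`; the rank condition on the
system is itself the nonvanishing of a polynomial if `r ≤ n`.) -/
def IsGenericSectionCard (V : Set (Fin n → K)) (r : ℕ) (δ : ℕ∞) : Prop :=
  ∃ G : MvPolynomial ((Fin r × Fin n) ⊕ Fin r) K, G ≠ 0 ∧
    ∀ (C : Matrix (Fin r) (Fin n) K) (b : Fin r → K),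
      eval (Sum.elim (fun p : Fin r × Fin n => C p.1 p.2) b) G ≠ 0 →
        (V ∩ linearSection C b).encard = δ

/-- The degree of an irreducible affine variety over an algebraically closed field: the number of
its intersections with an affine subspace of codimension `dim V` in general position. The infimum
is over a set with exactly one element. -/
def irreducibleDegree (V : Set (Fin n → K)) : ℕ∞ :=
  sInf {δ : ℕ∞ | ∃ r : ℕ, dimension V = r ∧ IsGenericSectionCard V r δ}

/-- The degree of an affine variety over an algebraically closed field: the sum of the degrees of
its (finitely many) irreducible components. -/
def degree (V : Set (Fin n → K)) : ℕ∞ :=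
  ∑ᶠ W ∈ components V, irreducibleDegree W

end Variety

section Construction

variable {F : Type*} [Field F] {m n : ℕ}

/-- Any `k` distinct columns of `M` are linearly independent. -/
def IsRegularMatrix (k : ℕ) (M : Matrix (Fin m) (Fin n) F) : Prop :=
  ∀ s : Finset (Fin n), s.card = k → LinearIndependent F (fun j : s => fun i : Fin m => M i j)

/-- The polynomials `fᵢ = ∑ⱼ cᵢⱼ Xⱼ ^ eⱼ`. -/
def dklPoly (M : Matrix (Fin m) (Fin n) F) (e : Fin n → ℕ) (i : Fin m) : MvPolynomial (Fin n) F :=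
  ∑ j, C (M i j) * X j ^ e j

/-- The degree of the affine variety `V(I)` over an arbitrary field `F`, where `V(I)` consists of
the common zeros of `I` with coordinates in the algebraic closure of `F`: by definition, the degree
of the same set as an affine variety over the algebraic closure. -/
def degreeOfIdeal (I : Ideal (MvPolynomial (Fin n) F)) : ℕ∞ :=
  degree (zeroLocus (AlgebraicClosure F) I)

end Construction

end NoetherNorm

end

/-!
Modulo a prime of the base change of `A` to the algebraic closure, a generator that is not integral
over `S` has value greater than `1` for some valuation that is at most `1` on `S`. By
`k`-regularity, the largest of the values of the `aⱼ ^ eⱼ` is then attained more than `k` times, and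
since the exponents are pairwise coprime and greater than `d`, the monomials of degree at most `d`
in `k + 1` of the corresponding `aⱼ` have pairwise distinct values. Hence these `aⱼ` satisfy no
polynomial relation of degree at most `d`.

Such a relation exists, however, because of the degree bound. Let `W` be an irreducible component,
of dimension `r`. Its image under `r + 1` linear forms in general position lies on an irreducible
hypersurface `P = 0`, which a generic line meets in `deg P` points. Each of them lifts to a point of
`W`, by finiteness of the projection, and the lifts lie on a generic affine subspace of codimension
`r`, so that `deg P ≤ deg W ≤ d`. The absence of relations of degree at most `d` is an open
condition on the linear forms, so that the existence of relations passes from linear forms in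
general position to the coordinates.
-/

noncomputable section

namespace NoetherNorm

open MvPolynomial Filter

section Generic

variable (K V : Type*) [Field K] [AddCommGroup V] [Module K V]

/-- The algebra of polynomial functions on a vector space `V`, generated by the linear forms. -/
def polynomialFunctions : Subalgebra K (V → K) :=
  Algebra.adjoin K (Set.range fun φ : Module.Dual K V => ⇑φ)

variable {K V} {W : Type*} [AddCommGroup W] [Module K W]

theorem dual_mem_polynomialFunctions (φ : Module.Dual K V) : ⇑φ ∈ polynomialFunctions K V :=
  Algebra.subset_adjoin ⟨φ, rfl⟩

theorem apply_mem_polynomialFunctions {ι : Type*} (i : ι) :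
    (fun v : ι → K => v i) ∈ polynomialFunctions K (ι → K) :=
  dual_mem_polynomialFunctions (LinearMap.proj i : (ι → K) →ₗ[K] K)

theorem comp_mem_polynomialFunctions {g : W → V}
    (hg : ∀ φ : Module.Dual K V, φ ∘ g ∈ polynomialFunctions K W) {f : V → K}
    (hf : f ∈ polynomialFunctions K V) : f ∘ g ∈ polynomialFunctions K W := by
  induction hf using Algebra.adjoin_induction with
  | mem _ hφ => obtain ⟨φ, rfl⟩ := hφ; exact hg φ
  | algebraMap c => exact algebraMap_mem _ c
  | add _ _ _ _ h₁ h₂ => exact add_mem h₁ h₂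
  | mul _ _ _ _ h₁ h₂ => exact mul_mem h₁ h₂

theorem comp_linearMap_add_const_mem_polynomialFunctions (g : W →ₗ[K] V) (c : V) {f : V → K}
    (hf : f ∈ polynomialFunctions K V) : (fun w => f (g w + c)) ∈ polynomialFunctions K W := by
  refine comp_mem_polynomialFunctions (g := fun w => g w + c) (fun φ => ?_) hf
  have : φ ∘ (fun w => g w + c) = ⇑(φ ∘ₗ g) + algebraMap K (W → K) (φ c) := by
    ext w; simp [Pi.algebraMap_apply]
  exact this ▸ add_mem (dual_mem_polynomialFunctions _) (algebraMap_mem _ _)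

theorem eval_mem_polynomialFunctions {σ : Type*} {u : σ → V → K}
    (hu : ∀ i, u i ∈ polynomialFunctions K V) (P : MvPolynomial σ K) :
    (fun v => eval (fun i => u i v) P) ∈ polynomialFunctions K V := by
  induction P using MvPolynomial.induction_on with
  | C c => simp only [eval_C]; exact algebraMap_mem _ c
  | add P Q hP hQ => simp only [map_add]; exact add_mem hP hQ
  | mul_X P i hP => simp only [map_mul, eval_X]; exact mul_mem hP (hu i)

theorem dual_aeval_mem_polynomialFunctions [Module.Finite K V] {B σ : Type*} [CommRing B]
    [Algebra K B] (u : σ → V →ₗ[K] B) (P : MvPolynomial σ K) (φ : Module.Dual K B) :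
    (fun v => φ (aeval (fun i => u i v) P)) ∈ polynomialFunctions K V := by
  induction P using MvPolynomial.induction_on generalizing φ with
  | C c => simp only [algHom_C]; exact (polynomialFunctions K V).algebraMap_mem _
  | add P Q hP hQ => simp only [map_add]; exact add_mem (hP φ) (hQ φ)
  | mul_X P i hP =>
    let b := Module.finBasis K V
    have expand : (fun v => φ (aeval (fun i => u i v) (P * X i))) = ∑ j, (b.coord j : V → K) *
        fun v => (φ ∘ₗ LinearMap.mulRight K (u i (b j))) (aeval (fun i => u i v) P) := by
      ext v
      conv_lhs =>
        rw [map_mul, aeval_X, ← b.sum_repr v, map_sum, Finset.mul_sum, map_sum, b.sum_repr]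
      simp
    exact expand ▸ sum_mem fun j _ => mul_mem (dual_mem_polynomialFunctions _) (hP _)

theorem exists_eval_eq_of_mem_polynomialFunctions {f : V → K} (hf : f ∈ polynomialFunctions K V)
    (x y : V) : ∃ p : Polynomial K, ∀ t, p.eval t = f (x + t • y) := by
  induction hf using Algebra.adjoin_induction with
  | mem _ hφ =>
    obtain ⟨φ, rfl⟩ := hφ
    exact ⟨.C (φ x) + .C (φ y) * .X, fun t => by simp [mul_comm t]⟩
  | algebraMap c => exact ⟨.C c, fun t => by simp⟩
  | add _ _ _ _ h₁ h₂ =>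
    obtain ⟨p, hp⟩ := h₁
    obtain ⟨q, hq⟩ := h₂
    exact ⟨p + q, fun t => by simp [hp, hq]⟩
  | mul _ _ _ _ h₁ h₂ =>
    obtain ⟨p, hp⟩ := h₁
    obtain ⟨q, hq⟩ := h₂
    exact ⟨p * q, fun t => by simp [hp, hq]⟩

variable [Infinite K]

theorem mul_ne_zero_of_mem_polynomialFunctions {f g : V → K} (hf : f ∈ polynomialFunctions K V)
    (hg : g ∈ polynomialFunctions K V) (hf0 : f ≠ 0) (hg0 : g ≠ 0) : f * g ≠ 0 := by
  obtain ⟨x, hx⟩ := Function.ne_iff.mp hf0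
  obtain ⟨y, hy⟩ := Function.ne_iff.mp hg0
  obtain ⟨p, hp⟩ := exists_eval_eq_of_mem_polynomialFunctions hf x (y - x)
  obtain ⟨q, hq⟩ := exists_eval_eq_of_mem_polynomialFunctions hg x (y - x)
  have hp0 : p ≠ 0 := by rintro rfl; exact hx (by simpa using (hp 0).symm)
  have hq0 : q ≠ 0 := by rintro rfl; exact hy (by simpa using (hq 1).symm)
  obtain ⟨t, ht⟩ : ∃ t, (p * q).eval t ≠ 0 := by
    by_contra! h
    exact mul_ne_zero hp0 hq0 (Polynomial.funext fun t => by rw [h t, Polynomial.eval_zero])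
  intro h
  exact ht (by rw [Polynomial.eval_mul, hp, hq]; exact congr_fun h _)

variable (K V) in
/-- The filter of the sets that contain the nonvanishing locus of some nonzero polynomial function:
`∀ᶠ v in generic K V, p v` says that `p` holds in general position. -/
def generic : Filter V where
  sets := {s | ∃ f ∈ polynomialFunctions K V, f ≠ 0 ∧ ∀ v, f v ≠ 0 → v ∈ s}
  univ_sets := ⟨1, one_mem _, one_ne_zero, fun _ _ => trivial⟩
  sets_of_superset := fun ⟨f, hf, hf0, h⟩ hst => ⟨f, hf, hf0, fun v hv => hst (h v hv)⟩
  inter_sets := fun ⟨f, hf, hf0, h⟩ ⟨g, hg, hg0, h'⟩ =>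
    ⟨f * g, mul_mem hf hg, mul_ne_zero_of_mem_polynomialFunctions hf hg hf0 hg0,
      fun v hv => ⟨h v (left_ne_zero_of_mul hv), h' v (right_ne_zero_of_mul hv)⟩⟩

theorem eventually_generic {p : V → Prop} : (∀ᶠ v in generic K V, p v) ↔
    ∃ f ∈ polynomialFunctions K V, (∃ v, f v ≠ 0) ∧ ∀ v, f v ≠ 0 → p v := by
  simp only [← Function.ne_iff]
  rfl

theorem eventually_ne_zero {f : V → K} (hf : f ∈ polynomialFunctions K V) {v₀ : V}
    (h₀ : f v₀ ≠ 0) : ∀ᶠ v in generic K V, f v ≠ 0 :=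
  eventually_generic.mpr ⟨f, hf, ⟨v₀, h₀⟩, fun _ => id⟩

instance : (generic K V).NeBot :=
  ⟨fun h => by
    obtain ⟨f, -, ⟨v, hv⟩, hf⟩ := eventually_generic.mp (eventually_false_iff_eq_bot.mpr h)
    exact hf v hv⟩

theorem tendsto_generic {g : W → V}
    (hg : ∀ φ : Module.Dual K V, φ ∘ g ∈ polynomialFunctions K W) (hsurj : g.Surjective) :
    Tendsto g (generic K W) (generic K V) := by
  rintro s ⟨f, hf, hf0, hs⟩
  obtain ⟨v, hv⟩ := Function.ne_iff.mp hf0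
  obtain ⟨w, rfl⟩ := hsurj v
  exact mem_of_superset (eventually_ne_zero (comp_mem_polynomialFunctions hg hf) hv)
    fun w hw => hs _ hw

theorem eventually_eventually_generic_of_prod {p : V × W → Prop}
    (h : ∀ᶠ z in generic K (V × W), p z) :
    ∀ᶠ v in generic K V, ∀ᶠ w in generic K W, p (v, w) := by
  obtain ⟨f, hf, ⟨⟨v₀, w₀⟩, h₀⟩, hp⟩ := eventually_generic.mp h
  have hfst : (fun v => f (v, w₀)) ∈ polynomialFunctions K V := by
    simpa using comp_linearMap_add_const_mem_polynomialFunctions (.inl K V W) (0, w₀) hf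
  have hsnd (v : V) : (fun w => f (v, w)) ∈ polynomialFunctions K W := by
    simpa using comp_linearMap_add_const_mem_polynomialFunctions (.inr K V W) (v, 0) hf
  filter_upwards [eventually_ne_zero hfst h₀] with v hv
  filter_upwards [eventually_ne_zero (hsnd v) hv] with w hw
  exact hp _ hw

theorem eventually_injective {M N : Type*} [AddCommGroup M] [Module K M] [Module.Finite K M]
    [AddCommGroup N] [Module K N] {T : V → M →ₗ[K] N}
    (hT : ∀ (φ : Module.Dual K N) (m : M), (fun v => φ (T v m)) ∈ polynomialFunctions K V)
    {v₀ : V} (h₀ : Function.Injective (T v₀)) :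
    ∀ᶠ v in generic K V, Function.Injective (T v) := by
  obtain ⟨g, hg⟩ := (T v₀).exists_leftInverse_of_injective (LinearMap.ker_eq_bot.mpr h₀)
  let b := Module.finBasis K M
  have hdet : (fun v => LinearMap.det (g ∘ₗ T v)) ∈ polynomialFunctions K V := by
    have : (fun v => LinearMap.det (g ∘ₗ T v)) = ∑ σ : Equiv.Perm _, σ.sign •
        ∏ j, fun v => (b.coord (σ j) ∘ₗ g) (T v (b j)) := by
      ext v
      simp [← LinearMap.det_toMatrix b, Matrix.det_apply, LinearMap.toMatrix_apply]
    rw [this]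
    exact sum_mem fun σ _ => zsmul_mem (prod_mem fun j _ => hT _ _) _
  have hdet₀ : LinearMap.det (g ∘ₗ T v₀) ≠ 0 := by simp [hg]
  filter_upwards [eventually_ne_zero hdet hdet₀] with v hv
  have : Function.Injective (g ∘ₗ T v) :=
    (LinearEquiv.ofIsUnitDet (f := g ∘ₗ T v) (v := b) (v' := b)
      (by rw [LinearMap.det_toMatrix]; exact hv.isUnit)).injective
  exact Function.Injective.of_comp this

end Generic

section Integrality

theorem isIntegral_of_adjoin {K B : Type*} [CommRing K] [CommRing B] [Algebra K B] {s : Set B}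
    [Algebra.IsIntegral (Algebra.adjoin K s) B] {S : Subalgebra K B}
    (hs : ∀ x ∈ s, IsIntegral S x) : Algebra.IsIntegral S B := by
  have hle : Algebra.adjoin K s ≤ (integralClosure S B).restrictScalars K := Algebra.adjoin_le hs
  refine ⟨fun x => isIntegral_trans (A := integralClosure S B) x ?_⟩
  exact (Algebra.IsIntegral.isIntegral (R := Algebra.adjoin K s) x).map_of_comp_eq
    (Subalgebra.inclusion hle).toRingHom (RingHom.id B) rfl

theorem isIntegral_of_forall_isPrime {R A : Type*} [CommRing R] [CommRing A] [Algebra R A] {x : A}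
    (h : ∀ p : Ideal A, p.IsPrime → IsIntegral R (Ideal.Quotient.mk p x)) : IsIntegral R x := by
  by_contra hx
  let T : Submonoid A :=
    { carrier := {y | ∃ g : Polynomial R, g.Monic ∧ Polynomial.aeval x g = y}
      one_mem' := ⟨1, Polynomial.monic_one, map_one _⟩
      mul_mem' := by
        rintro _ _ ⟨g, hg, rfl⟩ ⟨g', hg', rfl⟩
        exact ⟨g * g', hg.mul hg', map_mul _ _ _⟩ }
  have hT : Disjoint ((⊥ : Ideal A) : Set A) T := by
    rw [Set.disjoint_left]
    rintro _ hy ⟨g, hg, rfl⟩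
    exact hx ⟨g, hg, hy⟩
  obtain ⟨p, hp, -, hpT⟩ := Ideal.exists_le_prime_disjoint ⊥ T hT
  obtain ⟨g, hg, hgx⟩ := h p hp
  have hgp : Polynomial.aeval x g ∈ p := by
    rw [← Ideal.Quotient.eq_zero_iff_mem, ← Ideal.Quotient.mkₐ_eq_mk R,
      ← Polynomial.aeval_algHom_apply]
    exact hgx
  exact Set.disjoint_left.mp hpT hgp ⟨g, hg, rfl⟩

variable {R S : Type*} [CommRing R] [CommRing S] [Algebra R S] [Algebra.IsIntegral R S]

theorem ringKrullDim_le_of_isIntegral : ringKrullDim S ≤ ringKrullDim R :=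
  Order.krullDim_le_of_strictMono (PrimeSpectrum.comap (algebraMap R S)) fun _ _ h =>
    Ideal.IsIntegral.comap_lt_comap h

theorem ringKrullDim_eq_of_isIntegral (hinj : Function.Injective (algebraMap R S)) :
    ringKrullDim S = ringKrullDim R := by
  refine ringKrullDim_le_of_isIntegral.antisymm (iSup_le fun l => ?_)
  obtain ⟨Q, -, hQ, hQl⟩ := Ideal.exists_ideal_over_prime_of_isIntegral (S := S) l.head.asIdeal ⊥
    (by
      rw [← RingHom.ker_eq_comap_bot, (RingHom.injective_iff_ker_eq_bot (algebraMap R S)).mp hinj]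
      exact bot_le)
  have : Q.LiesOver (RelSeries.head l).asIdeal := ⟨hQl.symm⟩
  obtain ⟨l', hl', -⟩ := Ideal.exists_ltSeries_of_hasGoingUp (S := S) l Q
  exact hl' ▸ Order.LTSeries.length_le_krullDim l'

variable {K B ι : Type*} [Field K] [CommRing B] [Algebra K B] {z : ι → B}
  [Algebra.IsIntegral (Algebra.adjoin K (Set.range z)) B]

theorem ringKrullDim_range_aeval :
    ringKrullDim (aeval z : MvPolynomial ι K →ₐ[K] B).range = ringKrullDim B := by
  have : Algebra.IsIntegral (aeval z : MvPolynomial ι K →ₐ[K] B).range B := by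
    rw [← Algebra.adjoin_range_eq_range_aeval]
    infer_instance
  exact (ringKrullDim_eq_of_isIntegral Subtype.val_injective).symm

theorem ringKrullDim_mvPolynomial [Fintype ι] :
    ringKrullDim (MvPolynomial ι K) = Fintype.card ι := by
  rw [MvPolynomial.ringKrullDim_of_isNoetherianRing, ringKrullDim_eq_zero_of_field, zero_add,
    Nat.card_eq_fintype_card]

theorem algebraicIndependent_iff_card_le_ringKrullDim [Fintype ι] :
    AlgebraicIndependent K z ↔ Fintype.card ι ≤ ringKrullDim B := by
  rw [← ringKrullDim_range_aeval (K := K) (z := z)]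
  have hsurj := (aeval z : MvPolynomial ι K →ₐ[K] B).rangeRestrict_surjective
  refine ⟨fun h => ?_, fun hdim => ?_⟩
  · have hinj : Function.Injective (aeval z : MvPolynomial ι K →ₐ[K] B).rangeRestrict :=
      (AlgHom.injective_codRestrict _ _ _).mpr h
    rw [← ringKrullDim_mvPolynomial (K := K),
      ringKrullDim_eq_of_ringEquiv (AlgEquiv.ofBijective _ ⟨hinj, hsurj⟩).toRingEquiv]
  rw [algebraicIndependent_iff]
  intro p hp
  by_contra hp0
  have hrange := ringKrullDim_succ_le_of_surjective
    (aeval z : MvPolynomial ι K →ₐ[K] B).rangeRestrict.toRingHom hsurj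
    (mem_nonZeroDivisors_of_ne_zero hp0) (Subtype.ext hp)
  have : (Fintype.card ι : WithBot ℕ∞) + 1 ≤ Fintype.card ι :=
    le_trans (by gcongr) (hrange.trans ringKrullDim_mvPolynomial.le)
  norm_cast at this
  omega

theorem dvd_of_aeval_eq_zero [Fintype ι] (hdim : Fintype.card ι ≤ ringKrullDim B + 1)
    {P Q : MvPolynomial ι K} (hP : Prime P) (hPz : aeval z P = 0) (hQz : aeval z Q = 0) :
    P ∣ Q := by
  by_contra hPQ
  have : (Ideal.span {P}).IsPrime := (Ideal.span_singleton_prime hP.ne_zero).mpr hP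
  have hquot : ringKrullDim (MvPolynomial ι K ⧸ Ideal.span {P}) + 1 ≤ Fintype.card ι :=
    ringKrullDim_mvPolynomial (K := K) (ι := ι) ▸ ringKrullDim_succ_le_of_surjective
      (Ideal.Quotient.mk (Ideal.span {P})) Ideal.Quotient.mk_surjective
      (mem_nonZeroDivisors_of_ne_zero hP.ne_zero)
      (Ideal.Quotient.eq_zero_iff_mem.mpr (Ideal.mem_span_singleton_self P))
  have hker : ∀ a ∈ Ideal.span {P}, (aeval z : MvPolynomial ι K →ₐ[K] B).rangeRestrict a = 0 := by
    intro a ha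
    obtain ⟨c, rfl⟩ := Ideal.mem_span_singleton.mp ha
    exact Subtype.ext (by simp [hPz])
  have hrange : ringKrullDim B + 1 ≤ ringKrullDim (MvPolynomial ι K ⧸ Ideal.span {P}) := by
    rw [← ringKrullDim_range_aeval (K := K) (z := z)]
    refine ringKrullDim_succ_le_of_surjective (r := Ideal.Quotient.mk _ Q)
      (Ideal.Quotient.lift _ (aeval z : MvPolynomial ι K →ₐ[K] B).rangeRestrict.toRingHom hker)
      (Ideal.Quotient.lift_surjective_of_surjective _ _ (AlgHom.rangeRestrict_surjective _))
      (mem_nonZeroDivisors_of_ne_zero ?_) (Subtype.ext hQz)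
    rwa [Ne, Ideal.Quotient.eq_zero_iff_mem, Ideal.mem_span_singleton]
  have : (Fintype.card ι : WithBot ℕ∞) + 1 ≤ Fintype.card ι :=
    le_trans (by gcongr; exact hdim.trans hrange) hquot
  norm_cast at this
  omega

end Integrality

section Lines

variable {K R σ : Type*} [Field K] [CommRing R] [Algebra K R]

/-- The restriction of a polynomial to the parametrized line `a + t w`, as a polynomial in `t`. -/
def restrictLine (P : MvPolynomial σ K) (a : σ → R) (w : σ → K) : Polynomial R :=
  aeval (fun i => .C (a i) + .C (algebraMap K R (w i)) * .X) P

theorem aeval_restrictLine {B : Type*} [CommRing B] [Algebra K B] [Algebra R B]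
    [IsScalarTower K R B] (P : MvPolynomial σ K) (a : σ → R) (w : σ → K) (x : B) :
    Polynomial.aeval x (restrictLine P a w) =
      aeval (fun i => algebraMap R B (a i) + w i • x) P := by
  rw [restrictLine, ← AlgHom.restrictScalars_apply K, comp_aeval_apply]
  congr 2
  ext i
  simp [Algebra.smul_def, ← IsScalarTower.algebraMap_apply]

theorem natDegree_restrictLine_le {P : MvPolynomial σ K} {d : ℕ} (hP : P.totalDegree ≤ d)
    (a : σ → R) (w : σ → K) : (restrictLine P a w).natDegree ≤ d := by
  rw [restrictLine, ← aeval_map_algebraMap R]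
  have hmap : (map (algebraMap K R) P).totalDegree ≤ d :=
    (Finset.sup_mono (support_map_subset _ _)).trans hP
  refine mul_one d ▸ aeval_natDegree_le _ hmap _ fun i => ?_
  compute_degree

theorem coeff_restrictLine_monomial [Finite σ] (α : σ →₀ ℕ) (c : K) (a : σ → R) (w : σ → K) :
    (restrictLine (monomial α c) a w).coeff α.degree =
      algebraMap K R (eval w (monomial α c)) := by
  cases nonempty_fintype σ
  let s := Finset.univ.sigma fun i => Finset.range (α i)
  have hcard : s.card * 1 = α.degree := by simp [s, Finsupp.degree_eq_sum]
  have hprod : (α.prod fun i e => (.C (a i) + .C (algebraMap K R (w i)) * .X : Polynomial R) ^ e) =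
      ∏ j ∈ s, (.C (a j.1) + .C (algebraMap K R (w j.1)) * .X) := by
    simp [s, Finset.prod_sigma, Finsupp.prod_fintype]
  rw [restrictLine, aeval_monomial, hprod, Polynomial.algebraMap_apply, Polynomial.coeff_C_mul,
    ← hcard, Polynomial.coeff_prod_of_natDegree_le s
      (fun j => .C (a j.1) + .C (algebraMap K R (w j.1)) * .X) 1 fun _ _ => by compute_degree]
  simp [s, Polynomial.coeff_C, eval_monomial, Finset.prod_sigma, Finsupp.prod_fintype]

theorem coeff_restrictLine [Finite σ] {P : MvPolynomial σ K} {d : ℕ} (hP : P.totalDegree ≤ d)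
    (a : σ → R) (w : σ → K) :
    (restrictLine P a w).coeff d = algebraMap K R (eval w (homogeneousComponent d P)) := by
  have hsum : restrictLine P a w = ∑ α ∈ P.support, restrictLine (monomial α (coeff α P)) a w := by
    conv_lhs => rw [P.as_sum, restrictLine, map_sum]
    rfl
  rw [hsum, Polynomial.finsetSum_coeff, homogeneousComponent_apply, map_sum, map_sum,
    Finset.sum_filter]
  refine Finset.sum_congr rfl fun α hα => ?_
  split_ifs with hd
  · rw [← hd, coeff_restrictLine_monomial]
  · have hlt : α.degree < d := lt_of_le_of_ne ((le_totalDegree hα).trans hP) hd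
    exact Polynomial.coeff_eq_zero_of_natDegree_lt
      ((natDegree_restrictLine_le (totalDegree_monomial_le _ _) a w).trans_lt hlt)

/-- The derivative `∑ wᵢ ∂P/∂Xᵢ` of a polynomial in the direction `w`. -/
def directionalDerivative [Fintype σ] (w : σ → K) (P : MvPolynomial σ K) : MvPolynomial σ K :=
  ∑ i, C (w i) * pderiv i P

theorem derivative_restrictLine [Fintype σ] (P : MvPolynomial σ K) (a : σ → R) (w : σ → K) :
    (restrictLine P a w).derivative = restrictLine (directionalDerivative w P) a w := by
  classical
  simp only [restrictLine, directionalDerivative, map_sum, map_mul, algHom_C]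
  induction P using MvPolynomial.induction_on with
  | C c => simp [Polynomial.algebraMap_apply]
  | add P Q hP hQ => simp only [map_add, hP, hQ, mul_add, Finset.sum_add_distrib]
  | mul_X P i hP =>
    have hline : Polynomial.derivative (.C (a i) + .C (algebraMap K R (w i)) * .X) =
        .C (algebraMap K R (w i)) := by simp
    rw [map_mul, aeval_X, Polynomial.derivative_mul, hP, hline, add_comm]
    simp only [Derivation.leibniz, smul_eq_mul, map_add, map_mul, aeval_X,
      mul_add (algebraMap K _ _), Finset.sum_add_distrib]
    congr 1
    · rw [mul_comm]
      simp [pderiv_X, Pi.single_apply, Polynomial.algebraMap_apply]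
    · rw [Finset.sum_mul]
      exact Finset.sum_congr rfl fun _ _ => by ring

theorem totalDegree_directionalDerivative_lt [Fintype σ] {w : σ → K} {P : MvPolynomial σ K}
    (h : directionalDerivative w P ≠ 0) :
    (directionalDerivative w P).totalDegree < P.totalDegree := by
  have hlt : ∀ β ∈ (directionalDerivative w P).support, β.degree < P.totalDegree := by
    intro β hβ
    rw [mem_support_iff, directionalDerivative, coeff_sum] at hβ
    obtain ⟨i, -, hi⟩ := Finset.exists_ne_zero_of_sum_ne_zero hβ
    rw [coeff_C_mul, coeff_pderiv] at hi
    have hle : (β + Finsupp.single i 1).degree ≤ P.totalDegree :=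
      le_totalDegree (mem_support_iff.mpr (left_ne_zero_of_mul (right_ne_zero_of_mul hi)))
    rw [map_add, Finsupp.degree_single] at hle
    omega
  obtain ⟨β, hβ⟩ := support_nonempty.mpr h
  exact (Finset.sup_lt_iff (hlt β hβ).bot_lt).mpr hlt

theorem eval_smul_of_isHomogeneous [Finite σ] {P : MvPolynomial σ K} {d : ℕ}
    (hP : P.IsHomogeneous d) (c : K) (w : σ → K) : eval (c • w) P = c ^ d * eval w P := by
  cases nonempty_fintype σ
  rw [eval_eq', eval_eq', Finset.mul_sum]
  refine Finset.sum_congr rfl fun α hα => ?_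
  have hd : ∑ i, α i = d := by
    rw [← Finsupp.degree_eq_sum]
    exact (hP.degree_eq_sum_deg_support hα).symm
  rw [← hd, ← Finset.prod_pow_eq_pow_sum, mul_left_comm, ← Finset.prod_mul_distrib]
  simp only [Pi.smul_apply, smul_eq_mul, mul_pow]

theorem homogeneousComponent_totalDegree_ne_zero {P : MvPolynomial σ K} (hP : P ≠ 0) :
    homogeneousComponent P.totalDegree P ≠ 0 := by
  obtain ⟨α, hα, hdeg⟩ :=
    Finset.exists_mem_eq_sup P.support (support_nonempty.mpr hP) Finsupp.degree
  refine ne_zero_iff.mpr ⟨α, ?_⟩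
  rw [coeff_homogeneousComponent, if_pos (show α.degree = P.totalDegree from hdeg.symm)]
  exact mem_support_iff.mp hα

variable [Infinite K] {m : ℕ}

theorem eventually_cons_one {p : (Fin (m + 1) → K) → Prop}
    (hp : ∀ᶠ w in generic K (Fin (m + 1) → K), p w)
    (hsmul : ∀ (c : K) (w : Fin (m + 1) → K), c ≠ 0 → p (c • w) → p w) :
    ∀ᶠ v in generic K (Fin m → K), p (Fin.cons 1 v) := by
  have h0 : ∀ᶠ w in generic K (Fin (m + 1) → K), w 0 ≠ 0 :=
    eventually_ne_zero (apply_mem_polynomialFunctions 0) (v₀ := 1) one_ne_zero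
  obtain ⟨f, hf, ⟨w, hw⟩, hfp⟩ := eventually_generic.mp (hp.and h0)
  have hw0 : w 0 ≠ 0 := (hfp w hw).2
  let g : (Fin m → K) →ₗ[K] Fin (m + 1) → K :=
    w 0 • LinearMap.pi (Fin.cons 0 LinearMap.proj : Fin (m + 1) → (Fin m → K) →ₗ[K] K)
  have hg (v : Fin m → K) : g v + Pi.single 0 (w 0) = w 0 • (Fin.cons 1 v : Fin (m + 1) → K) := by
    ext i
    cases i using Fin.cases <;> simp [g]
  have hcons := comp_linearMap_add_const_mem_polynomialFunctions g (Pi.single 0 (w 0)) hf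
  simp only [hg] at hcons
  refine (eventually_ne_zero hcons (v₀ := (w 0)⁻¹ • Fin.tail w) ?_).mono fun v hv =>
    hsmul _ _ hw0 (hfp _ hv).1
  convert hw
  ext i
  cases i using Fin.cases <;> simp [hw0, Fin.tail]

theorem eventually_eval_homogeneousComponent_ne_zero {P : MvPolynomial (Fin (m + 1)) K}
    (hP : P ≠ 0) : ∀ᶠ v in generic K (Fin m → K),
      eval (Fin.cons 1 v) (homogeneousComponent P.totalDegree P) ≠ 0 := by
  refine eventually_cons_one (p := fun w => eval w (homogeneousComponent P.totalDegree P) ≠ 0)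
    ?_ fun c w _ h => ?_
  · obtain ⟨w, hw⟩ : ∃ w, eval w (homogeneousComponent P.totalDegree P) ≠ 0 := by
      by_contra! h
      exact homogeneousComponent_totalDegree_ne_zero hP
        (MvPolynomial.funext fun w => by rw [h w, map_zero])
    exact eventually_ne_zero (eval_mem_polynomialFunctions apply_mem_polynomialFunctions _) hw
  · rw [eval_smul_of_isHomogeneous (homogeneousComponent_isHomogeneous _ _)] at h
    exact right_ne_zero_of_mul h

theorem eventually_directionalDerivative_ne_zero {P : MvPolynomial (Fin (m + 1)) K}
    {i : Fin (m + 1)} (hi : pderiv i P ≠ 0) :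
    ∀ᶠ v in generic K (Fin m → K), directionalDerivative (Fin.cons 1 v) P ≠ 0 := by
  obtain ⟨α, hα⟩ := ne_zero_iff.mp hi
  refine eventually_cons_one (p := fun w => directionalDerivative w P ≠ 0) ?_ fun c w _ h => ?_
  · let φ : Module.Dual K (Fin (m + 1) → K) := ∑ j, coeff α (pderiv j P) • LinearMap.proj j
    have hφ (w : Fin (m + 1) → K) : φ w = coeff α (directionalDerivative w P) := by
      simp [φ, directionalDerivative, coeff_sum, coeff_C_mul, mul_comm]
    have hφi : φ (Pi.single i 1) ≠ 0 := by simpa [φ, Pi.single_apply] using hα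
    refine (eventually_ne_zero (dual_mem_polynomialFunctions φ) hφi).mono fun w hw h => hw ?_
    rw [hφ, h, coeff_zero]
  · rintro h0
    refine h ?_
    have : directionalDerivative (c • w) P = C c * directionalDerivative w P := by
      simp [directionalDerivative, Finset.mul_sum, mul_assoc]
    rw [this, h0, mul_zero]

end Lines

section Projection

variable {K M : Type*} [Field K] [AddCommGroup M] [Module K M] {m : ℕ}

/-- The projection of the coordinates `z₀, …, zₘ` along the direction `(1, v)` onto the hyperplane
where the first coordinate vanishes. -/
def projectAlong (v : Fin m → K) (z : Fin (m + 1) → M) : Fin m → M :=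
  fun i => z i.succ - v i • z 0

theorem projectAlong_comp_linearMap {N : Type*} [AddCommGroup N] [Module K N] (g : M →ₗ[K] N)
    (v : Fin m → K) (z : Fin (m + 1) → M) :
    projectAlong v (fun i => g (z i)) = fun i => g (projectAlong v z i) := by
  ext i
  simp [projectAlong]

theorem cons_zero_add_cons_one_smul {v : Fin m → K} {z : Fin (m + 1) → M} {y : Fin m → M}
    (h : projectAlong v z = y) (i : Fin (m + 1)) :
    (Fin.cons 0 y : Fin (m + 1) → M) i + (Fin.cons 1 v : Fin (m + 1) → K) i • z 0 = z i := by
  cases i using Fin.cases <;> simp [← h, projectAlong]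

theorem eventually_eventually_projectAlong [Infinite K] {p : (Fin m → M) → Prop}
    (hp : ∀ᶠ C in generic K (Fin m → M), p C) :
    ∀ᶠ C in generic K (Fin (m + 1) → M), ∀ᶠ v in generic K (Fin m → K), p (projectAlong v C) := by
  let g : (Fin (m + 1) → M) × (Fin m → K) → Fin m → M := fun w => projectAlong w.2 w.1
  have hg (φ : Module.Dual K (Fin m → M)) : φ ∘ g ∈ polynomialFunctions K _ := by
    let tail : (Fin (m + 1) → M) × (Fin m → K) →ₗ[K] Fin m → M :=
      LinearMap.funLeft K M Fin.succ ∘ₗ .fst K _ _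
    let single (i : Fin m) : (Fin (m + 1) → M) × (Fin m → K) →ₗ[K] Fin m → M :=
      .single K (fun _ => M) i ∘ₗ .proj 0 ∘ₗ .fst K _ _
    let coord (i : Fin m) : Module.Dual K ((Fin (m + 1) → M) × (Fin m → K)) :=
      .proj i ∘ₗ .snd K _ _
    have hφ : φ ∘ g = ⇑(φ ∘ₗ tail) - ∑ i, ⇑(coord i) * ⇑(φ ∘ₗ single i) := by
      ext w
      have hw : g w = tail w - ∑ i, w.2 i • single i w := by
        ext i
        simp [g, tail, single, projectAlong, Finset.sum_apply, Pi.single_apply, LinearMap.funLeft]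
      simp [hw, coord]
    exact hφ ▸ sub_mem (dual_mem_polynomialFunctions _) (sum_mem fun i _ =>
      mul_mem (dual_mem_polynomialFunctions _) (dual_mem_polynomialFunctions _))
  have hsurj : g.Surjective := fun C => ⟨(Fin.cons 0 C, 0), by ext i; simp [g, projectAlong]⟩
  exact eventually_eventually_generic_of_prod ((tendsto_generic hg hsurj).eventually hp)

end Projection

section NoetherNormalization

variable {K B : Type*} [Field K] [CommRing B] [Algebra K B] {m n : ℕ}

theorem isIntegral_projectAlong (z : Fin (m + 1) → B)
    [Algebra.IsIntegral (Algebra.adjoin K (Set.range z)) B] {P : MvPolynomial (Fin (m + 1)) K}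
    (hPz : aeval z P = 0) {v : Fin m → K}
    (hv : eval (Fin.cons 1 v) (homogeneousComponent P.totalDegree P) ≠ 0) :
    Algebra.IsIntegral (Algebra.adjoin K (Set.range (projectAlong v z))) B := by
  let S := Algebra.adjoin K (Set.range (projectAlong v z))
  let y : Fin m → S := fun i => ⟨projectAlong v z i, Algebra.subset_adjoin ⟨i, rfl⟩⟩
  have hz (i : Fin (m + 1)) : algebraMap S B ((Fin.cons 0 y : Fin (m + 1) → S) i) +
      (Fin.cons 1 v : Fin (m + 1) → K) i • z 0 = z i := by
    refine Eq.trans ?_ (cons_zero_add_cons_one_smul (v := v) rfl i)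
    cases i using Fin.cases <;> simp [y]
  have hz0 : IsIntegral S (z 0) := by
    set c := eval (Fin.cons 1 v) (homogeneousComponent P.totalDegree P) with hc
    refine ⟨.C (algebraMap K S c⁻¹) * restrictLine P (Fin.cons 0 y) (Fin.cons 1 v), ?_, ?_⟩
    · refine Polynomial.monic_of_natDegree_le_of_coeff_eq_one P.totalDegree
        ((Polynomial.natDegree_C_mul_le _ _).trans (natDegree_restrictLine_le le_rfl _ _)) ?_
      rw [Polynomial.coeff_C_mul, coeff_restrictLine le_rfl, ← hc, ← map_mul, inv_mul_cancel₀ hv,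
        map_one]
    · rw [← Polynomial.aeval_def, map_mul, aeval_restrictLine, funext hz, hPz, mul_zero]
  refine isIntegral_of_adjoin (K := K) (s := Set.range z) (Set.forall_mem_range.mpr fun i => ?_)
  rw [← hz i]
  exact isIntegral_algebraMap.add (hz0.smul _)

variable [Infinite K]

theorem eventually_isIntegral_linearCombination_of_le (x : Fin n → B)
    [Algebra.IsIntegral (Algebra.adjoin K (Set.range x)) B] (hnm : n ≤ m) :
    ∀ᶠ C in generic K (Fin m → Fin n → K), Algebra.IsIntegral
      (Algebra.adjoin K (Set.range fun i => Fintype.linearCombination K x (C i))) B := by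
  let minor (C : Fin m → Fin n → K) : Matrix (Fin n) (Fin n) K := .of fun i => C (i.castLE hnm)
  have hdet : (fun C => (minor C).det) ∈ polynomialFunctions K (Fin m → Fin n → K) := by
    have : (fun C => (minor C).det) = ∑ σ : Equiv.Perm (Fin n), σ.sign • ∏ j,
        ⇑(.proj j ∘ₗ .proj ((σ j).castLE hnm) : Module.Dual K (Fin m → Fin n → K)) := by
      ext C
      simp [Matrix.det_apply, minor]
    rw [this]
    refine sum_mem fun σ _ => zsmul_mem (prod_mem fun j _ => ?_) _
    exact dual_mem_polynomialFunctions _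
  let C₀ : Fin m → Fin n → K := fun i j => if i = j.castLE hnm then 1 else 0
  have hC₀ : minor C₀ = 1 := by
    ext i j
    simp [minor, C₀, Matrix.one_apply]
  filter_upwards [eventually_ne_zero hdet (v₀ := C₀) (by simp [hC₀])] with C hC
  let S := Algebra.adjoin K (Set.range fun i => Fintype.linearCombination K x (C i))
  have hS (i : Fin m) : IsIntegral S (Fintype.linearCombination K x (C i)) :=
    isIntegral_algebraMap (x := (⟨_, Algebra.subset_adjoin ⟨i, rfl⟩⟩ : S))
  refine isIntegral_of_adjoin (K := K) (s := Set.range x) (Set.forall_mem_range.mpr fun j => ?_)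
  have hrow : ∑ i, (minor C)⁻¹ j i • C (i.castLE hnm) = Pi.single j 1 := by
    ext l
    have := congr_fun₂ (Matrix.nonsing_inv_mul _ hC.isUnit) j l
    simpa [Matrix.mul_apply, minor, Matrix.one_apply, Pi.single_apply, eq_comm] using this
  have hx : x j = ∑ i, (minor C)⁻¹ j i • Fintype.linearCombination K x (C (i.castLE hnm)) := by
    simp_rw [← map_smul, ← map_sum, hrow, Fintype.linearCombination_apply_single, one_smul]
  exact hx ▸ IsIntegral.sum _ fun i _ => (hS _).smul _

theorem frequently_isIntegral_linearCombination (x : Fin n → B)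
    [Algebra.IsIntegral (Algebra.adjoin K (Set.range x)) B] (hdim : ringKrullDim B ≤ m) :
    ∃ᶠ C in generic K (Fin m → Fin n → K), Algebra.IsIntegral
      (Algebra.adjoin K (Set.range fun i => Fintype.linearCombination K x (C i))) B := by
  obtain ⟨k, hk⟩ : ∃ k, n ≤ m + k := ⟨n, by omega⟩
  induction k generalizing m with
  | zero => exact (eventually_isIntegral_linearCombination_of_le x hk).frequently
  | succ k ih =>
    intro hnot
    have hlt : (m : WithBot ℕ∞) < (m + 1 : ℕ) := by exact_mod_cast m.lt_succ_self
    obtain ⟨C, hC, hC'⟩ := ((ih (hdim.trans hlt.le) (by omega)).and_eventually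
      (eventually_eventually_projectAlong hnot)).exists
    set z := fun i => Fintype.linearCombination K x (C i) with hz
    have hdep : ¬ AlgebraicIndependent K z := by
      rw [algebraicIndependent_iff_card_le_ringKrullDim, Fintype.card_fin, not_le]
      exact hdim.trans_lt hlt
    rw [algebraicIndependent_iff] at hdep
    push Not at hdep
    obtain ⟨P, hPz, hP⟩ := hdep
    obtain ⟨v, hv, hv'⟩ :=
      ((eventually_eval_homogeneousComponent_ne_zero hP).and hC').exists
    have := isIntegral_projectAlong z hPz hv
    rw [hz, projectAlong_comp_linearMap] at this
    exact hv' this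

end NoetherNormalization

section Lifting

theorem exists_algHom_extending {K S B : Type*} [Field K] [IsAlgClosed K] [CommRing S]
    [Algebra K S] [CommRing B] [Algebra K B] [Algebra S B] [IsScalarTower K S B]
    [Algebra.IsIntegral S B] (θ : S →ₐ[K] K)
    (hθ : RingHom.ker (algebraMap S B) ≤ RingHom.ker θ) :
    ∃ ψ : B →ₐ[K] K, ∀ s, ψ (algebraMap S B s) = θ s := by
  have hprime : (RingHom.ker θ).IsPrime := RingHom.ker_isPrime θ
  obtain ⟨N, -, hN, hNθ⟩ := Ideal.exists_ideal_over_prime_of_isIntegral (S := B) (RingHom.ker θ) ⊥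
    (by rwa [← RingHom.ker_eq_comap_bot])
  have hmk (s : S) : Ideal.Quotient.mk N (algebraMap S B s) = algebraMap K (B ⧸ N) (θ s) := by
    have : s - algebraMap K S (θ s) ∈ N.comap (algebraMap S B) := by
      rw [hNθ, RingHom.mem_ker, map_sub, AlgHom.commutes, Algebra.algebraMap_self_apply, sub_self]
    rw [Ideal.mem_comap, map_sub, ← IsScalarTower.algebraMap_apply] at this
    exact Ideal.Quotient.eq.mpr this
  have : Algebra.IsIntegral K (B ⧸ N) := by
    refine ⟨fun x => ?_⟩
    obtain ⟨x, rfl⟩ := Ideal.Quotient.mk_surjective x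
    exact (Algebra.IsIntegral.isIntegral (R := S) x).map_of_comp_eq (θ : S →+* K)
      (Ideal.Quotient.mk N) (RingHom.ext fun s => (hmk s).symm)
  let e : K ≃ₐ[K] B ⧸ N := .ofBijective (Algebra.ofId K (B ⧸ N))
    IsAlgClosed.algebraMap_bijective_of_isIntegral
  refine ⟨e.symm.toAlgHom.comp (Ideal.Quotient.mkₐ K N), fun s => ?_⟩
  exact e.symm_apply_eq.mpr (hmk s)

variable {K B ι : Type*} [Field K] [CommRing B] [Algebra K B] {z : ι → B}
  [Algebra.IsIntegral (Algebra.adjoin K (Set.range z)) B]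

theorem exists_algHom_apply_eq [IsAlgClosed K] {x : ι → K}
    (hx : ∀ Q : MvPolynomial ι K, aeval z Q = 0 → aeval x Q = 0) :
    ∃ ψ : B →ₐ[K] K, ∀ i, ψ (z i) = x i := by
  have : Algebra.IsIntegral (aeval z : MvPolynomial ι K →ₐ[K] B).range B := by
    rw [← Algebra.adjoin_range_eq_range_aeval]
    infer_instance
  obtain ⟨ψ, hψ⟩ := exists_algHom_extending (B := B)
    (AlgHom.liftOfSurjective (aeval z : MvPolynomial ι K →ₐ[K] B).rangeRestrict
      (AlgHom.rangeRestrict_surjective _) (aeval x) fun Q hQ => hx Q (congrArg Subtype.val hQ))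
    (fun s hs => by rw [show s = 0 from Subtype.ext hs]; exact zero_mem _)
  refine ⟨ψ, fun i => ?_⟩
  have hzi : algebraMap _ B ((aeval z : MvPolynomial ι K →ₐ[K] B).rangeRestrict (X i)) = z i :=
    aeval_X z i
  rw [← hzi, hψ]
  exact (AlgHom.liftOfSurjective_apply _ _ _ _ (X i)).trans (aeval_X x i)

theorem eventually_forall_algHom_ne_zero [Finite ι] [Infinite K] [IsDomain B] {x : B}
    (hx : x ≠ 0) :
    ∀ᶠ b in generic K (ι → K), ∀ ψ : B →ₐ[K] K, (∀ i, ψ (z i) = b i) → ψ x ≠ 0 := by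
  obtain ⟨s, hs, hxs⟩ := (Algebra.IsIntegral.isIntegral (R := Algebra.adjoin K (Set.range z))
    x).isAlgebraic.exists_nonzero_dvd (mem_nonZeroDivisors_of_ne_zero hx)
  obtain ⟨G, hG⟩ : (s : B) ∈ (aeval z : MvPolynomial ι K →ₐ[K] B).range := by
    rw [← Algebra.adjoin_range_eq_range_aeval]
    exact s.2
  obtain ⟨b₀, hb₀⟩ : ∃ b, eval b G ≠ 0 := by
    by_contra! h
    have hG₀ : G = 0 := MvPolynomial.funext fun b => by rw [h b, map_zero]
    exact hs (Subtype.ext (hG.symm.trans (by rw [hG₀, map_zero]; rfl)))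
  filter_upwards [eventually_ne_zero (eval_mem_polynomialFunctions apply_mem_polynomialFunctions G)
    hb₀] with b hb ψ hψ hψx
  refine hb ?_
  have hdvd : ψ x ∣ ψ (aeval z G) := map_dvd ψ (hG ▸ hxs)
  rwa [hψx, zero_dvd_iff, comp_aeval_apply, funext hψ, aeval_eq_eval] at hdvd

end Lifting

section MinimalRelation

variable {K ι : Type*} [Field K]

theorem pderiv_ne_zero_of_mem_support {P : MvPolynomial ι K} {α : ι →₀ ℕ} (hα : α ∈ P.support)
    {i : ι} (hi : (α i : K) ≠ 0) : pderiv i P ≠ 0 := by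
  have hi₀ : α i ≠ 0 := by rintro h; simp [h] at hi
  obtain ⟨β, rfl⟩ : ∃ β, α = β + Finsupp.single i 1 :=
    ⟨_, (tsub_add_cancel_of_le (by simpa [Nat.one_le_iff_ne_zero] using hi₀)).symm⟩
  refine ne_zero_iff.mpr ⟨β, ?_⟩
  rw [coeff_pderiv]
  exact mul_ne_zero (mem_support_iff.mp hα) (by simpa using hi)

theorem exists_pderiv_ne_zero [PerfectField K] {L : Type*} [Field L] [Algebra K L] {a : ι → L}
    {P : MvPolynomial ι K} (hP : P ≠ 0) (hPa : aeval a P = 0)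
    (hmin : ∀ Q : MvPolynomial ι K, Q ≠ 0 → aeval a Q = 0 → P.totalDegree ≤ Q.totalDegree) :
    ∃ i, pderiv i P ≠ 0 := by
  suffices h : ∃ i, ∃ α ∈ P.support, (α i : K) ≠ 0 by
    obtain ⟨i, α, hα, hi⟩ := h
    exact ⟨i, pderiv_ne_zero_of_mem_support hα hi⟩
  obtain _ | ⟨p, hp, hpk⟩ := CharP.exists' K
  · by_contra! h
    obtain ⟨c, rfl⟩ : ∃ c, P = C c := by
      refine ⟨_, totalDegree_eq_zero_iff_eq_C.mp ((totalDegree_eq_zero_iff ι P).mpr ?_)⟩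
      exact fun α hα i => by exact_mod_cast h i α hα
    rw [aeval_C, map_eq_zero] at hPa
    exact hP (by rw [hPa, C_0])
  · have : ExpChar K p := .prime hp.out
    have : CharP L p := .of_ringHom_of_ne_zero (algebraMap K L) p hp.out.ne_zero
    have hfrob (s : Finset L) (hs : LinearIndepOn K id (s : Set L)) :
        LinearIndepOn K (· ^ p) (s : Set L) := by
      refine hs.map_of_injective_injective (frobeniusEquiv K p).symm
        (frobenius L p).toAddMonoidHom (by simp) (by simp [frobenius]) fun c x => ?_
      change ((frobeniusEquiv K p).symm c • x) ^ p = c • x ^ p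
      rw [smul_pow, frobeniusEquiv_symm_pow_p]
    obtain ⟨i, α, hα, hi⟩ :=
      exists_mem_support_not_dvd_of_forall_totalDegree_le p hp.out hfrob hmin hP hPa
    exact ⟨i, α, hα, fun h => hi ((CharP.cast_eq_zero_iff K p _).mp h)⟩

theorem exists_minimal_relation [PerfectField K] {B : Type*} [CommRing B] [IsDomain B]
    [Algebra K B] {z : ι → B} (hz : ¬ AlgebraicIndependent K z) :
    ∃ P : MvPolynomial ι K, Irreducible P ∧ aeval z P = 0 ∧ (∃ i, pderiv i P ≠ 0) ∧
      ∀ Q : MvPolynomial ι K, Q ≠ 0 → aeval z Q = 0 → P.totalDegree ≤ Q.totalDegree := by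
  rw [algebraicIndependent_iff] at hz
  push Not at hz
  obtain ⟨P₀, hP₀z, hP₀⟩ := hz
  obtain ⟨P, ⟨hP, hPz⟩, hmin⟩ := (InvImage.wf (totalDegree (R := K) (σ := ι))
    wellFounded_lt).has_min {P | P ≠ 0 ∧ aeval z P = 0} ⟨P₀, hP₀, hP₀z⟩
  replace hmin (Q : MvPolynomial ι K) (hQ : Q ≠ 0) (hQz : aeval z Q = 0) :
      P.totalDegree ≤ Q.totalDegree := not_lt.mp (hmin Q ⟨hQ, hQz⟩)
  simp only [← aeval_algebraMap_eq_zero_iff (FractionRing B) z] at hmin hPz ⊢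
  exact ⟨P, irreducible_of_forall_totalDegree_le hmin hP hPz, hPz,
    exists_pderiv_ne_zero hP hPz hmin, hmin⟩

end MinimalRelation

section FiberPoints

variable {K B : Type*} [Field K] [IsAlgClosed K] [CommRing B] [Algebra K B]

theorem exists_algHom_of_isRoot_restrictLine {ι : Type*} [Fintype ι] {z : ι → B}
    [Algebra.IsIntegral (Algebra.adjoin K (Set.range z)) B]
    (hdim : Fintype.card ι ≤ ringKrullDim B + 1) {P : MvPolynomial ι K} (hP : Irreducible P)
    (hPz : aeval z P = 0) {a w : ι → K} {t : K} (ht : (restrictLine P a w).IsRoot t) :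
    ∃ ψ : B →ₐ[K] K, ∀ i, ψ (z i) = a i + w i * t := by
  refine exists_algHom_apply_eq fun Q hQ => ?_
  obtain ⟨Q, rfl⟩ := dvd_of_aeval_eq_zero hdim hP.prime hPz hQ
  have hPt : aeval (fun i => a i + w i * t) P = 0 :=
    (aeval_restrictLine P a w t).symm.trans (by rw [Polynomial.coe_aeval_eq_eval, ht.eq_zero])
  rw [map_mul, hPt, zero_mul]

theorem exists_finset_algHom_restrictLine {ι : Type*} [Fintype ι] {z : ι → B}
    [Algebra.IsIntegral (Algebra.adjoin K (Set.range z)) B]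
    (hdim : Fintype.card ι ≤ ringKrullDim B + 1) {P : MvPolynomial ι K} (hP : Irreducible P)
    (hPz : aeval z P = 0) {a w : ι → K} (hw : eval w (homogeneousComponent P.totalDegree P) ≠ 0)
    (hder : ∀ (ψ : B →ₐ[K] K) (t : K), (∀ i, ψ (z i) = a i + w i * t) →
      ψ (aeval z (directionalDerivative w P)) ≠ 0) :
    ∃ T : Finset K, T.card = P.totalDegree ∧
      ∀ t ∈ T, ∃ ψ : B →ₐ[K] K, ∀ i, ψ (z i) = a i + w i * t := by
  classical
  set p := restrictLine P a w with hp
  have hcoeff : p.coeff P.totalDegree ≠ 0 := by simpa [hp, coeff_restrictLine le_rfl] using hw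
  have hdeg : p.natDegree = P.totalDegree :=
    Polynomial.natDegree_eq_of_le_of_coeff_ne_zero (natDegree_restrictLine_le le_rfl _ _) hcoeff
  have hp₀ : p ≠ 0 := by rintro h; simp [h] at hcoeff
  have hlift (t : K) (ht : p.IsRoot t) : ∃ ψ : B →ₐ[K] K, ∀ i, ψ (z i) = a i + w i * t :=
    exists_algHom_of_isRoot_restrictLine hdim hP hPz ht
  have hsep : p.Separable := by
    refine (Polynomial.isCoprime_iff_aeval_ne_zero_of_isAlgClosed K K _ _).mpr fun t => ?_
    by_contra! h
    obtain ⟨ψ, hψ⟩ := hlift t (by simpa using h.1)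
    refine hder ψ t hψ ?_
    rw [comp_aeval_apply, funext hψ, ← h.2, derivative_restrictLine, aeval_restrictLine]
    rfl
  refine ⟨p.roots.toFinset, ?_, fun t ht => hlift t (by simpa [hp₀] using ht)⟩
  rw [Multiset.toFinset_card_of_nodup (Polynomial.nodup_roots hsep), ← hdeg]
  exact (IsAlgClosed.splits p).natDegree_eq_card_roots.symm

theorem eventually_exists_finset_algHom_projectAlong [IsDomain B] {r d : ℕ}
    {z : Fin (r + 1) → B} [Algebra.IsIntegral (Algebra.adjoin K (Set.range z)) B]
    (hdim : ringKrullDim B = r)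
    (hz : ∀ P : MvPolynomial (Fin (r + 1)) K, P ≠ 0 → aeval z P = 0 → d < P.totalDegree) :
    ∀ᶠ v in generic K (Fin r → K), ∀ᶠ b in generic K (Fin r → K), ∃ T : Finset K, d < T.card ∧
      ∀ t ∈ T, ∃ ψ : B →ₐ[K] K, (∀ i, ψ (projectAlong v z i) = b i) ∧ ψ (z 0) = t := by
  have hdep : ¬ AlgebraicIndependent K z := by
    rw [algebraicIndependent_iff_card_le_ringKrullDim, hdim, Fintype.card_fin]
    exact_mod_cast Nat.not_succ_le_self r
  obtain ⟨P, hP, hPz, ⟨i, hi⟩, hmin⟩ := exists_minimal_relation hdep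
  filter_upwards [eventually_eval_homogeneousComponent_ne_zero hP.ne_zero,
    eventually_directionalDerivative_ne_zero hi] with v hv hvder
  have := isIntegral_projectAlong z hPz hv
  have hder : aeval z (directionalDerivative (Fin.cons 1 v) P) ≠ 0 := fun h =>
    (hmin _ hvder h).not_gt (totalDegree_directionalDerivative_lt hvder)
  filter_upwards [eventually_forall_algHom_ne_zero (z := projectAlong v z) hder] with b hb
  have hline (ψ : B →ₐ[K] K) (t : K) :
      (∀ i, ψ (z i) = (Fin.cons 0 b : Fin (r + 1) → K) i + (Fin.cons 1 v : Fin (r + 1) → K) i * t) ↔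
        (∀ i, ψ (projectAlong v z i) = b i) ∧ ψ (z 0) = t := by
    rw [Fin.forall_fin_succ, and_comm]
    simp only [Fin.cons_zero, Fin.cons_succ, zero_add, one_mul, projectAlong, map_sub, map_smul,
      smul_eq_mul, sub_eq_iff_eq_add]
    exact and_congr_left fun ht => by rw [ht]
  obtain ⟨T, hT, hTψ⟩ := exists_finset_algHom_restrictLine (by simp [hdim]) hP hPz hv
    fun ψ t hψ => hb ψ ((hline ψ t).mp hψ).1
  simp only [hline] at hTψ
  exact ⟨T, hT ▸ hz P hP.ne_zero hPz, hTψ⟩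

end FiberPoints

section GenericSection

variable {K B : Type*} [Field K] [CommRing B] [Algebra K B] {n r d : ℕ}

theorem eventually_forall_aeval_ne_zero [Infinite K] {V σ : Type*} [AddCommGroup V] [Module K V]
    [Module.Finite K V] [Finite σ] (u : σ → V →ₗ[K] B) {v₀ : V}
    (h₀ : ∀ P : MvPolynomial σ K, P ≠ 0 → P.totalDegree ≤ d → aeval (fun i => u i v₀) P ≠ 0) :
    ∀ᶠ v in generic K V,
      ∀ P : MvPolynomial σ K, P ≠ 0 → P.totalDegree ≤ d → aeval (fun i => u i v) P ≠ 0 := by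
  let T (v : V) : restrictTotalDegree σ K d →ₗ[K] B :=
    (aeval fun i => u i v).toLinearMap ∘ₗ Submodule.subtype _
  have hT (v : V) : Function.Injective (T v) ↔
      ∀ P : MvPolynomial σ K, P ≠ 0 → P.totalDegree ≤ d → aeval (fun i => u i v) P ≠ 0 := by
    simp only [injective_iff_map_eq_zero, Subtype.forall, mem_restrictTotalDegree, T]
    simp only [LinearMap.comp_apply, Submodule.subtype_apply, AlgHom.toLinearMap_apply,
      Submodule.mk_eq_zero]
    exact forall_congr' fun P => by tauto
  simp only [← hT] at h₀ ⊢
  exact eventually_injective (fun φ P => dual_aeval_mem_polynomialFunctions u P.1 φ) h₀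

theorem exists_aeval_linearCombination_eq_zero [IsAlgClosed K] [IsDomain B]
    (hdim : ringKrullDim B = r) (x : Fin n → B)
    [Algebra.IsIntegral (Algebra.adjoin K (Set.range x)) B]
    (hcard : ∀ᶠ C in generic K (Fin r → Fin n → K), ∀ᶠ b in generic K (Fin r → K),
      {ψ : B →ₐ[K] K | ∀ i, ψ (Fintype.linearCombination K x (C i)) = b i}.encard ≤ d)
    (L : Fin (r + 1) → Fin n → K) :
    ∃ P : MvPolynomial (Fin (r + 1)) K, P ≠ 0 ∧ P.totalDegree ≤ d ∧
      aeval (fun i => Fintype.linearCombination K x (L i)) P = 0 := by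
  have : Infinite K := IsAlgClosed.instInfinite
  by_contra! hL
  have hrel := eventually_forall_aeval_ne_zero
    (fun i => Fintype.linearCombination K x ∘ₗ (.proj i : (Fin (r + 1) → Fin n → K) →ₗ[K] _)) hL
  have hint := frequently_isIntegral_linearCombination (K := K) (m := r + 1) x
    (hdim.trans_le (by exact_mod_cast r.le_succ))
  obtain ⟨C, hC, hCrel, hCcard⟩ := (hint.and_eventually
    (hrel.and (eventually_eventually_projectAlong hcard))).exists
  have hfiber := eventually_exists_finset_algHom_projectAlong (d := d)
    (z := fun i => Fintype.linearCombination K x (C i)) hdim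
    fun P hP hPC => not_le.mp fun hPd => hCrel P hP hPd hPC
  obtain ⟨v, hv, hvcard⟩ := (hfiber.and hCcard).exists
  obtain ⟨b, ⟨T, hT, hTψ⟩, hb⟩ := (hv.and hvcard).exists
  rw [projectAlong_comp_linearMap] at hTψ
  have hTle : (T : Set K).encard ≤
      {ψ : B →ₐ[K] K | ∀ i, ψ (Fintype.linearCombination K x (projectAlong v C i)) = b i}.encard :=
    (Set.encard_le_encard fun t ht => hTψ t ht).trans (Set.encard_image_le
      (fun ψ : B →ₐ[K] K => ψ (Fintype.linearCombination K x (C 0))) _)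
  rw [Set.encard_coe_eq_coe_finsetCard] at hTle
  exact hT.not_ge (by exact_mod_cast hTle.trans hb)

theorem IsGenericSectionCard.eventually_encard_eq [Infinite K] {V : Set (Fin n → K)} {δ : ℕ∞}
    (h : IsGenericSectionCard V r δ) :
    ∀ᶠ C in generic K (Fin r → Fin n → K), ∀ᶠ b in generic K (Fin r → K),
      (V ∩ linearSection (.of C) b).encard = δ := by
  obtain ⟨G, hG, hcard⟩ := h
  refine eventually_eventually_generic_of_prod
    (p := fun w => (V ∩ linearSection (.of w.1) w.2).encard = δ) ?_
  obtain ⟨y, hy⟩ : ∃ y, eval y G ≠ 0 := by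
    by_contra! h
    exact hG (MvPolynomial.funext fun y => by rw [h y, map_zero])
  let coord : (Fin r × Fin n) ⊕ Fin r → Module.Dual K ((Fin r → Fin n → K) × (Fin r → K)) :=
    Sum.elim (fun p => .proj p.2 ∘ₗ .proj p.1 ∘ₗ .fst K _ _) fun i => .proj i ∘ₗ .snd K _ _
  have hcoord (w : (Fin r → Fin n → K) × (Fin r → K)) :
      (fun i => coord i w) = Sum.elim (fun p => w.1 p.1 p.2) w.2 := by
    ext (_ | _) <;> rfl
  refine (eventually_ne_zero (eval_mem_polynomialFunctions
    (fun i => dual_mem_polynomialFunctions (coord i)) G)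
    (v₀ := (fun i j => y (.inl (i, j)), fun i => y (.inr i))) ?_).mono fun w hw => ?_
  · rw [hcoord]
    convert hy using 3
    exact Sum.elim_comp_inl_inr y
  · exact hcard _ _ (by rwa [hcoord] at hw)

theorem exists_relation_of_isGenericSectionCard [IsAlgClosed K]
    (Q : Ideal (MvPolynomial (Fin n) K)) [Q.IsPrime]
    (hdim : ringKrullDim (MvPolynomial (Fin n) K ⧸ Q) = r) {δ : ℕ∞} (hδ : δ ≤ d)
    (hQ : IsGenericSectionCard (zeroLocus K Q) r δ) (ι : Fin (r + 1) → Fin n) :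
    ∃ P : MvPolynomial (Fin (r + 1)) K, P ≠ 0 ∧ P.totalDegree ≤ d ∧ rename ι P ∈ Q := by
  have : Infinite K := IsAlgClosed.instInfinite
  let x : Fin n → MvPolynomial (Fin n) K ⧸ Q := fun j => Ideal.Quotient.mkₐ K Q (X j)
  have haeval : aeval x = Ideal.Quotient.mkₐ K Q := MvPolynomial.algHom_ext fun j => aeval_X x j
  have hψ (ψ : MvPolynomial (Fin n) K ⧸ Q →ₐ[K] K) (P : MvPolynomial (Fin n) K) :
      ψ (Ideal.Quotient.mkₐ K Q P) = aeval (fun j => ψ (x j)) P := by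
    rw [← haeval, comp_aeval_apply]
  have hint : Algebra.IsIntegral (Algebra.adjoin K (Set.range x)) (MvPolynomial (Fin n) K ⧸ Q) := by
    rw [Algebra.adjoin_range_eq_range_aeval, haeval]
    exact ⟨fun y => isIntegral_algebraMap (x := (⟨y, Ideal.Quotient.mkₐ_surjective K Q y⟩ :
      (Ideal.Quotient.mkₐ K Q).range))⟩
  have hcard : ∀ᶠ C in generic K (Fin r → Fin n → K), ∀ᶠ b in generic K (Fin r → K),
      {ψ : MvPolynomial (Fin n) K ⧸ Q →ₐ[K] K |
        ∀ i, ψ (Fintype.linearCombination K x (C i)) = b i}.encard ≤ d := by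
    filter_upwards [hQ.eventually_encard_eq] with C hC
    filter_upwards [hC] with b hb
    refine (Set.encard_le_encard_of_injOn (f := fun ψ j => ψ (x j)) ?_ ?_).trans (hb.trans_le hδ)
    · refine fun ψ hψb => ⟨fun P hP => ?_, funext fun i => ?_⟩
      · rw [← hψ, Ideal.Quotient.mkₐ_eq_mk, Ideal.Quotient.eq_zero_iff_mem.mpr hP, map_zero]
      · simpa [Fintype.linearCombination_apply, Matrix.mulVec, dotProduct] using hψb i
    · intro ψ _ ψ' _ h
      refine Ideal.Quotient.algHom_ext _ (MvPolynomial.algHom_ext fun j => congr_fun h j)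
  obtain ⟨P, hP, hPd, hPx⟩ :=
    exists_aeval_linearCombination_eq_zero hdim x hcard fun i => Pi.single (ι i) 1
  refine ⟨P, hP, hPd, ?_⟩
  rw [← Ideal.Quotient.eq_zero_iff_mem, ← Ideal.Quotient.mkₐ_eq_mk K, ← haeval, aeval_rename]
  simpa [Fintype.linearCombination_apply_single, Function.comp_def] using hPx

end GenericSection

section Varieties

variable {K : Type*} [Field K] {n : ℕ}

theorem IsAffineVariety.zeroLocus_vanishingIdeal {V : Set (Fin n → K)} (hV : IsAffineVariety V) :
    zeroLocus K (vanishingIdeal K V) = V := by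
  obtain ⟨I, rfl⟩ := hV
  exact zeroLocus_vanishingIdeal_galoisConnection.l_u_l_eq_l I

theorem IsAffineVariety.sep_aeval_eq_zero {V : Set (Fin n → K)} (hV : IsAffineVariety V)
    (f : MvPolynomial (Fin n) K) : IsAffineVariety {x ∈ V | aeval x f = 0} := by
  obtain ⟨I, rfl⟩ := hV
  refine ⟨I ⊔ Ideal.span {f}, Set.ext fun x => ?_⟩
  change I ≤ RingHom.ker (aeval x) ∧ f ∈ RingHom.ker (aeval x) ↔ _ ≤ RingHom.ker (aeval x)
  rw [sup_le_iff, Ideal.span_singleton_le_iff_mem]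

theorem IsIrreducibleVariety.isPrime_vanishingIdeal {W : Set (Fin n → K)}
    (hW : IsIrreducibleVariety W) : (vanishingIdeal K W).IsPrime := by
  obtain ⟨hWa, ⟨x, hx⟩, hirr⟩ := hW
  refine ⟨(Ideal.ne_top_iff_one _).mpr fun h => by simpa using h x hx, fun {f g} hfg => ?_⟩
  have hunion : W = {y ∈ W | aeval y f = 0} ∪ {y ∈ W | aeval y g = 0} := by
    rw [← Set.sep_or, eq_comm, Set.sep_eq_self_iff_mem_true]
    exact fun y hy => by simpa using hfg y hy
  exact (hirr _ _ (hWa.sep_aeval_eq_zero f) (hWa.sep_aeval_eq_zero g) hunion).imp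
    Set.sep_eq_self_iff_mem_true.mp Set.sep_eq_self_iff_mem_true.mp

theorem exists_isGenericSectionCard_irreducibleDegree {V : Set (Fin n → K)}
    (hV : irreducibleDegree V ≠ ⊤) :
    ∃ r : ℕ, dimension V = r ∧ IsGenericSectionCard V r (irreducibleDegree V) := by
  refine csInf_mem (s := {δ : ℕ∞ | ∃ r : ℕ, dimension V = r ∧ IsGenericSectionCard V r δ})
    (Set.nonempty_iff_ne_empty.mpr fun h => hV ?_)
  rw [irreducibleDegree, h, sInf_empty]

variable [IsAlgClosed K]

theorem isIrreducibleVariety_zeroLocus (Q : Ideal (MvPolynomial (Fin n) K)) [hQ : Q.IsPrime] :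
    IsIrreducibleVariety (zeroLocus K Q) := by
  have hvan : vanishingIdeal K (zeroLocus K Q) = Q := IsPrime.vanishingIdeal_zeroLocus Q
  refine ⟨⟨Q, rfl⟩, ?_, fun V₁ V₂ hV₁ hV₂ hunion => ?_⟩
  · rw [Set.nonempty_iff_ne_empty]
    intro h
    rw [h, vanishingIdeal_empty] at hvan
    exact hQ.ne_top hvan.symm
  · have hle : vanishingIdeal K V₁ ⊓ vanishingIdeal K V₂ ≤ Q := by
      rw [← hvan, hunion]
      exact fun p hp x hx => hx.elim (hp.1 x) (hp.2 x)
    refine (hQ.inf_le.mp hle).imp (fun h => ?_) fun h => ?_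
    · refine (hunion ▸ Set.subset_union_left).antisymm ?_
      exact (zeroLocus_anti_mono h).trans_eq hV₁.zeroLocus_vanishingIdeal
    · refine (hunion ▸ Set.subset_union_right).antisymm ?_
      exact (zeroLocus_anti_mono h).trans_eq hV₂.zeroLocus_vanishingIdeal

/-- The Nullstellensatz correspondence between the irreducible subvarieties of `V(I)` and the prime
ideals containing `I`, which computes the dimension of `V(I)`. -/
def irreducibleSubvarietyOrderIso (I : Ideal (MvPolynomial (Fin n) K)) :
    {W : Set (Fin n → K) // IsIrreducibleVariety W ∧ W ⊆ zeroLocus K I} ≃o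
      (PrimeSpectrum.zeroLocus (I : Set (MvPolynomial (Fin n) K)))ᵒᵈ where
  toFun W := OrderDual.toDual ⟨⟨vanishingIdeal K W.1, W.2.1.isPrime_vanishingIdeal⟩,
    le_zeroLocus_iff_le_vanishingIdeal.mp W.2.2⟩
  invFun P := ⟨zeroLocus K (OrderDual.ofDual P).1.asIdeal,
    isIrreducibleVariety_zeroLocus _, zeroLocus_anti_mono (OrderDual.ofDual P).2⟩
  left_inv W := Subtype.ext W.2.1.1.zeroLocus_vanishingIdeal
  right_inv P := OrderDual.ofDual.injective (Subtype.ext (PrimeSpectrum.ext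
    (IsPrime.vanishingIdeal_zeroLocus _)))
  map_rel_iff' := by
    refine fun {W₁ W₂} => ⟨fun h => ?_, fun h => vanishingIdeal_anti_mono h⟩
    have hle : vanishingIdeal K W₂.1 ≤ vanishingIdeal K W₁.1 := h
    have := zeroLocus_anti_mono (K := K) hle
    rwa [W₁.2.1.1.zeroLocus_vanishingIdeal, W₂.2.1.1.zeroLocus_vanishingIdeal] at this

theorem dimension_zeroLocus (I : Ideal (MvPolynomial (Fin n) K)) :
    dimension (zeroLocus K I) = ringKrullDim (MvPolynomial (Fin n) K ⧸ I) := by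
  rw [dimension, ringKrullDim_quotient, Order.krullDim_eq_of_orderIso
    (irreducibleSubvarietyOrderIso I), Order.krullDim_orderDual]

theorem zeroLocus_mem_components {I Q : Ideal (MvPolynomial (Fin n) K)}
    (hQ : Q ∈ I.minimalPrimes) : zeroLocus K Q ∈ components (zeroLocus K I) := by
  have := hQ.1.1
  refine ⟨⟨isIrreducibleVariety_zeroLocus Q, zeroLocus_anti_mono hQ.1.2⟩, fun Z hZ hQZ => ?_⟩
  have hZQ : vanishingIdeal K Z ≤ Q :=
    (vanishingIdeal_anti_mono hQZ).trans_eq (IsPrime.vanishingIdeal_zeroLocus Q)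
  have hQZ : Q ≤ vanishingIdeal K Z :=
    hQ.2 ⟨hZ.1.isPrime_vanishingIdeal, le_zeroLocus_iff_le_vanishingIdeal.mp hZ.2⟩ hZQ
  exact hZ.1.1.zeroLocus_vanishingIdeal.symm.trans_subset (zeroLocus_anti_mono hQZ)

theorem finite_components (I : Ideal (MvPolynomial (Fin n) K)) :
    (components (zeroLocus K I)).Finite := by
  refine ((Ideal.finite_minimalPrimes_of_isNoetherianRing _ I).image (zeroLocus K)).subset ?_
  refine fun W hW => ⟨vanishingIdeal K W, ⟨⟨hW.1.1.isPrime_vanishingIdeal,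
    le_zeroLocus_iff_le_vanishingIdeal.mp hW.1.2⟩, fun J hJ hJW => ?_⟩,
    hW.1.1.1.zeroLocus_vanishingIdeal⟩
  have := hJ.1
  have hWJ := hW.2 ⟨isIrreducibleVariety_zeroLocus J, zeroLocus_anti_mono hJ.2⟩
    (le_zeroLocus_iff_le_vanishingIdeal.mpr hJW)
  exact (vanishingIdeal_anti_mono hWJ).trans_eq (IsPrime.vanishingIdeal_zeroLocus J)

theorem irreducibleDegree_le_degree {I Q : Ideal (MvPolynomial (Fin n) K)}
    (hQ : Q ∈ I.minimalPrimes) :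
    irreducibleDegree (zeroLocus K Q) ≤ degree (zeroLocus K I) := by
  rw [degree, finsum_mem_eq_finite_toFinset_sum _ (finite_components I)]
  exact Finset.single_le_sum (f := irreducibleDegree) (fun _ _ => zero_le)
    ((finite_components I).mem_toFinset.mpr (zeroLocus_mem_components hQ))

theorem exists_relation_of_degree_le {I P : Ideal (MvPolynomial (Fin n) K)} [P.IsPrime]
    (hIP : I ≤ P) {k d : ℕ} (hdim : ringKrullDim (MvPolynomial (Fin n) K ⧸ I) ≤ k)
    (hdeg : degree (zeroLocus K I) ≤ d) (ι : Fin (k + 1) → Fin n) :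
    ∃ R : MvPolynomial (Fin (k + 1)) K, R ≠ 0 ∧ R.totalDegree ≤ d ∧ rename ι R ∈ P := by
  obtain ⟨Q, hQ, hQP⟩ := Ideal.exists_minimalPrimes_le hIP
  have := hQ.1.1
  have hQdeg := (irreducibleDegree_le_degree hQ).trans hdeg
  obtain ⟨r, hr, hsection⟩ := exists_isGenericSectionCard_irreducibleDegree
    (hQdeg.trans_lt (ENat.natCast_lt_top d)).ne
  rw [dimension_zeroLocus] at hr
  have hrk : r + 1 ≤ k + 1 := by
    have hle := ringKrullDim_le_of_surjective (Ideal.Quotient.factor hQ.1.2)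
      (Ideal.Quotient.factor_surjective hQ.1.2)
    rw [hr] at hle
    exact Nat.succ_le_succ (by exact_mod_cast hle.trans hdim)
  obtain ⟨R, hR, hRd, hRQ⟩ := exists_relation_of_isGenericSectionCard Q hr hQdeg hsection
    (ι ∘ Fin.castLE hrk)
  refine ⟨rename (Fin.castLE hrk) R, (map_ne_zero_iff _
    (rename_injective _ (Fin.castLE_injective hrk))).mpr hR,
    (totalDegree_rename_le _ _).trans hRd, ?_⟩
  rw [rename_rename]
  exact hQP hRQ

end Varieties

section Valuation

variable {ι : Type*}

theorem eq_of_sum_mul_prod_erase_eq [Fintype ι] [DecidableEq ι] {e α β : ι → ℕ}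
    (hcop : Pairwise fun i j => Nat.Coprime (e i) (e j)) (hα : ∀ i, α i < e i)
    (hβ : ∀ i, β i < e i)
    (h : ∑ i, α i * ∏ j ∈ Finset.univ.erase i, e j =
      ∑ i, β i * ∏ j ∈ Finset.univ.erase i, e j) : α = β := by
  funext i
  have hmod (γ : ι → ℕ) : ∑ l, γ l * ∏ j ∈ Finset.univ.erase l, e j ≡
      γ i * ∏ j ∈ Finset.univ.erase i, e j [MOD e i] := by
    rw [← Finset.add_sum_erase _ _ (Finset.mem_univ i)]
    refine Nat.ModEq.add_left _ ((Nat.modEq_zero_iff_dvd).mpr ?_)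
    refine Finset.dvd_sum fun l hl => Dvd.dvd.mul_left (Finset.dvd_prod_of_mem _ ?_) _
    exact Finset.mem_erase.mpr ⟨(Finset.ne_of_mem_erase hl).symm, Finset.mem_univ i⟩
  have hcopi : Nat.Coprime (e i) (∏ j ∈ Finset.univ.erase i, e j) :=
    Nat.Coprime.prod_right fun j hj => hcop (Finset.ne_of_mem_erase hj).symm
  have hαβ := (hmod α).symm.trans (h ▸ hmod β)
  exact (Nat.ModEq.cancel_right_of_coprime hcopi hαβ).eq_of_lt_of_lt (hα i) (hβ i)

variable {Γ : Type*} [LinearOrderedCommGroupWithZero Γ]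

theorem eq_of_prod_pow_eq [Fintype ι] {e α β : ι → ℕ}
    (hcop : Pairwise fun i j => Nat.Coprime (e i) (e j)) {w : Γ} (hw : 1 < w)
    {y : ι → Γ} (hy : ∀ i, y i ^ e i = w) (hα : ∀ i, α i < e i)
    (hβ : ∀ i, β i < e i) (h : ∏ i, y i ^ α i = ∏ i, y i ^ β i) : α = β := by
  classical
  have hpow (γ : ι → ℕ) : (∏ i, y i ^ γ i) ^ (∏ i, e i) =
      w ^ (∑ i, γ i * ∏ j ∈ Finset.univ.erase i, e j) := by
    rw [← Finset.prod_pow, ← Finset.prod_pow_eq_pow_sum]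
    refine Finset.prod_congr rfl fun i _ => ?_
    rw [← hy i, ← pow_mul, ← pow_mul, ← Finset.mul_prod_erase Finset.univ e (Finset.mem_univ i),
      mul_left_comm]
  refine eq_of_sum_mul_prod_erase_eq hcop hα hβ ?_
  apply pow_right_injective₀ (zero_lt_one.trans hw) hw.ne'
  simp only [← hpow, h]

variable {E : Type*} [Field E] (v : Valuation E Γ)

theorem valuation_algebraMap_eq_one {K : Type*} [Field K] [Algebra K E]
    (hv : ∀ c : K, v (algebraMap K E c) ≤ 1) {c : K} (hc : c ≠ 0) :
    v (algebraMap K E c) = 1 := by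
  refine (hv c).antisymm ((inv_le_one₀ (zero_lt_iff.mpr (by simpa using hc))).mp ?_)
  simpa only [map_inv₀] using hv c⁻¹

-- The monomials of `P` have pairwise distinct values, so the largest one is the value of `P`.
theorem aeval_ne_zero_of_valuation_pow_eq [Finite ι] {K : Type*} [Field K] [Algebra K E]
    (hv : ∀ c : K, v (algebraMap K E c) ≤ 1) {x : ι → E} {e : ι → ℕ}
    (hcop : Pairwise fun i j => Nat.Coprime (e i) (e j)) {w : Γ} (hw : 1 < w)
    (hx : ∀ i, v (x i) ^ e i = w) {P : MvPolynomial ι K} (hP : P ≠ 0)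
    (hdeg : ∀ i, P.totalDegree < e i) : aeval x P ≠ 0 := by
  classical
  cases nonempty_fintype ι
  have hlt {α : ι →₀ ℕ} (hα : α ∈ P.support) (i : ι) : α i < e i :=
    ((Finsupp.le_degree i α).trans (le_totalDegree hα)).trans_lt (hdeg i)
  have hval {α : ι →₀ ℕ} (hα : α ∈ P.support) :
      v (algebraMap K E (P.coeff α) * ∏ i, x i ^ α i) = ∏ i, v (x i) ^ α i := by
    simp only [map_mul, map_prod, map_pow, one_mul,
      valuation_algebraMap_eq_one v hv (mem_support_iff.mp hα)]
  obtain ⟨α, hα, hmax⟩ := P.support.exists_max_image (fun α => ∏ i, v (x i) ^ α i)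
    (support_nonempty.mpr hP)
  have hvP : v (aeval x P) = ∏ i, v (x i) ^ α i := by
    rw [aeval_def, eval₂_eq', ← hval hα]
    refine v.map_sum_eq_of_lt hα fun β hβ => ?_
    obtain ⟨hβ, hβα⟩ := Finset.mem_sdiff.mp hβ
    rw [hval hα, hval hβ]
    refine (hmax β hβ).lt_of_ne fun h => hβα (Finset.mem_singleton.mpr ?_)
    exact DFunLike.coe_injective (eq_of_prod_pow_eq hcop hw hx (hlt hβ) (hlt hα) h)
  have hx0 (i : ι) : v (x i) ≠ 0 := fun h => by
    have hwi := hx i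
    rw [h, zero_pow (hdeg i).ne_bot] at hwi
    exact (zero_lt_one.trans hw).ne hwi
  rw [← v.ne_zero_iff, hvP]
  exact Finset.prod_ne_zero_iff.mpr fun i _ => pow_ne_zero _ (hx0 i)

variable {F : Type*} [Field F]

theorem exists_dual_apply_eq_single {V σ : Type*} [AddCommGroup V] [Module F V] {u : σ → V}
    (hu : LinearIndependent F u) (i : σ) :
    ∃ φ : Module.Dual F V, ∀ j, φ (u j) = Finsupp.single j 1 i := by
  obtain ⟨φ, hφ⟩ := (Finsupp.lapply i ∘ₗ hu.repr).exists_extend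
  refine ⟨φ, fun j => ?_⟩
  let uj : Submodule.span F (Set.range u) := ⟨u j, Submodule.subset_span (Set.mem_range_self j)⟩
  have huj : φ (u j) = hu.repr uj i := LinearMap.congr_fun hφ uj
  rw [huj, hu.repr_eq_single j uj rfl]

variable [Algebra F E] {κ : Type*} [Finite κ] {M : Matrix κ ι F} {y : ι → E}

-- A functional that is dual to column `j₀` on `s` combines the rows into `y j₀` plus smaller terms.
theorem valuation_le_one_of_linearIndependent [Fintype ι] (hv : ∀ c : F, v (algebraMap F E c) ≤ 1)
    (hM : ∀ i, v (∑ j, M i j • y j) ≤ 1) {s : Finset ι}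
    (hs : LinearIndependent F (fun j : s => fun i => M i j)) {j₀ : ι} (hj₀ : j₀ ∈ s)
    (hlt : ∀ j ∉ s, v (y j) < v (y j₀)) : v (y j₀) ≤ 1 := by
  classical
  cases nonempty_fintype κ
  obtain ⟨φ, hφ⟩ := exists_dual_apply_eq_single hs ⟨j₀, hj₀⟩
  have hφs {j : ι} (hj : j ∈ s) : φ (fun i => M i j) = if j = j₀ then 1 else 0 := by
    simpa [Finsupp.single_apply] using hφ ⟨j, hj⟩
  have hsmul (c : F) (z : E) : v (c • z) ≤ v z := by
    rw [Algebra.smul_def, map_mul]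
    exact mul_le_of_le_one_left' (hv c)
  rcases eq_or_ne (v (y j₀)) 0 with h0 | h0
  · exact h0.trans_le zero_le_one
  have hcomb : ∑ j, φ (fun i => M i j) • y j =
      ∑ i, φ (fun l => if i = l then 1 else 0) • ∑ j, M i j • y j := by
    simp_rw [φ.pi_apply_eq_sum_univ (fun i => M i _), Finset.sum_smul, Finset.smul_sum, smul_smul,
      smul_eq_mul, mul_comm]
    exact Finset.sum_comm
  have hlead : v (∑ j, φ (fun i => M i j) • y j) = v (φ (fun i => M i j₀) • y j₀) := by
    refine v.map_sum_eq_of_lt (Finset.mem_univ j₀) fun j hj => ?_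
    have hjj₀ : j ≠ j₀ := by simpa using hj
    rw [hφs hj₀, if_pos rfl, one_smul]
    by_cases hjs : j ∈ s
    · simpa [hφs hjs, hjj₀] using zero_lt_iff.mpr h0
    · exact (hsmul _ _).trans_lt (hlt j hjs)
  rw [hφs hj₀, if_pos rfl, one_smul, hcomb] at hlead
  exact hlead ▸ v.map_sum_le fun i _ => (hsmul _ _).trans (hM i)

end Valuation

section RegularMatrix

variable {F : Type*} [Field F] {m n : ℕ} {M : Matrix (Fin m) (Fin n) F}

theorem aeval_dklPoly {B : Type*} [CommRing B] [Algebra F B] (x : Fin n → B) (e : Fin n → ℕ)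
    (i : Fin m) : aeval x (dklPoly M e i) = ∑ j, M i j • x j ^ e j := by
  simp [dklPoly, Algebra.smul_def]

variable {E : Type*} [Field E] [Algebra F E] {k : ℕ}

theorem IsRegularMatrix.exists_card_eq {Γ : Type*} [LinearOrderedCommGroupWithZero Γ]
    (hM : IsRegularMatrix k M) (hkn : k ≤ n) (v : Valuation E Γ)
    (hv : ∀ c : F, v (algebraMap F E c) ≤ 1) {y : Fin n → E}
    (hsum : ∀ i, v (∑ j, M i j • y j) ≤ 1) {j₁ : Fin n} (hj₁ : 1 < v (y j₁)) :
    ∃ w : Γ, 1 < w ∧ ∃ s : Finset (Fin n), s.card = k + 1 ∧ ∀ j ∈ s, v (y j) = w := by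
  classical
  obtain ⟨j₀, -, hmax⟩ := Finset.univ.exists_max_image (fun j => v (y j)) ⟨j₁, Finset.mem_univ _⟩
  have hj₀ : 1 < v (y j₀) := hj₁.trans_le (hmax j₁ (Finset.mem_univ _))
  let maximal : Finset (Fin n) := {j | v (y j) = v (y j₀)}
  suffices hcard : k + 1 ≤ maximal.card by
    obtain ⟨s, hs, hcard⟩ := Finset.exists_subset_card_eq hcard
    exact ⟨_, hj₀, s, hcard, fun j hj => (Finset.mem_filter.mp (hs hj)).2⟩
  by_contra! hcard
  obtain ⟨s, hmaxs, -, hs⟩ := Finset.exists_subsuperset_card_eq (Finset.subset_univ maximal)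
    (Nat.le_of_lt_succ hcard) (by simpa using hkn)
  refine hj₀.not_ge (valuation_le_one_of_linearIndependent v hv hsum (hM s hs)
    (hmaxs (by simp [maximal])) fun j hj => (hmax j (Finset.mem_univ j)).lt_of_ne fun h => ?_)
  exact hj (hmaxs (by simp [maximal, h]))

variable {R : Type*} [CommRing R] [Algebra R E]

theorem exists_valuationSubring_of_not_isIntegral {x : E} (hx : ¬ IsIntegral R x) :
    ∃ V : ValuationSubring E, (∀ y, IsIntegral R y → y ∈ V) ∧ x ∉ V := by
  have : IsIntegrallyClosedIn (integralClosure R E).toSubring E :=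
    inferInstanceAs (IsIntegrallyClosedIn (integralClosure R E) E)
  exact Subring.exists_le_valuationSubring_of_isIntegrallyClosedIn
    (R := (integralClosure R E).toSubring) hx

theorem IsRegularMatrix.isIntegral_of_relations (hM : IsRegularMatrix k M) (hkn : k ≤ n)
    {K : Type*} [Field K] [Algebra F K] [Algebra K E] [IsScalarTower F K E]
    (hK : ∀ c : K, IsIntegral R (algebraMap K E c)) {d : ℕ} {e : Fin n → ℕ}
    (he : ∀ j, d < e j) (hcop : Pairwise fun i j => Nat.Coprime (e i) (e j)) {x : Fin n → E}
    (hf : ∀ i, IsIntegral R (aeval x (dklPoly M e i)))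
    (hrel : ∀ ι : Fin (k + 1) → Fin n, Function.Injective ι →
      ∃ P : MvPolynomial (Fin (k + 1)) K, P ≠ 0 ∧ P.totalDegree ≤ d ∧ aeval (x ∘ ι) P = 0)
    (j : Fin n) : IsIntegral R (x j) := by
  by_contra hj
  obtain ⟨V, hV, hjV⟩ := exists_valuationSubring_of_not_isIntegral hj
  have hvK (c : K) : V.valuation (algebraMap K E c) ≤ 1 :=
    (V.valuation_le_one_iff _).mpr (hV _ (hK c))
  have hvf (i : Fin m) : V.valuation (∑ j, M i j • x j ^ e j) ≤ 1 :=
    (V.valuation_le_one_iff _).mpr (hV _ (aeval_dklPoly (M := M) x e i ▸ hf i))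
  have hvx : 1 < V.valuation (x j ^ e j) := by
    rw [map_pow]
    refine one_lt_pow₀ (lt_of_not_ge fun h => hjV ((V.valuation_le_one_iff _).mp h)) ?_
    exact (he j).ne_bot
  obtain ⟨w, hw, s, hs, hsw⟩ := hM.exists_card_eq hkn V.valuation
    (fun c => IsScalarTower.algebraMap_apply F K E c ▸ hvK _) hvf hvx
  have hinj : Function.Injective (s.orderEmbOfFin hs) := (s.orderEmbOfFin hs).injective
  obtain ⟨P, hP, hPd, hP0⟩ := hrel _ hinj
  refine aeval_ne_zero_of_valuation_pow_eq V.valuation hvK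
    (hcop.comp_of_injective hinj) hw (fun i => ?_) hP (fun i => hPd.trans_lt (he _)) hP0
  rw [← hsw _ (s.orderEmbOfFin_mem hs i), map_pow]
  rfl

end RegularMatrix

section BaseChange

open scoped TensorProduct

theorem exists_relation_of_surjective_aeval {K B : Type*} [Field K] [IsAlgClosed K] [CommRing B]
    [Algebra K B] {n k d : ℕ} {x : Fin n → B}
    (hx : Function.Surjective (aeval x : MvPolynomial (Fin n) K →ₐ[K] B))
    (hdim : ringKrullDim B ≤ k)
    (hdeg : degree (zeroLocus K (RingHom.ker (aeval x : MvPolynomial (Fin n) K →ₐ[K] B))) ≤ d)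
    (q : Ideal B) [q.IsPrime] (ι : Fin (k + 1) → Fin n) :
    ∃ R : MvPolynomial (Fin (k + 1)) K,
      R ≠ 0 ∧ R.totalDegree ≤ d ∧ aeval (x ∘ ι) R ∈ q := by
  let φ : MvPolynomial (Fin n) K →ₐ[K] B := aeval x
  have hdimφ : ringKrullDim (MvPolynomial (Fin n) K ⧸ RingHom.ker φ) ≤ k :=
    (ringKrullDim_eq_of_ringEquiv (RingHom.quotientKerEquivOfSurjective hx)).trans_le hdim
  obtain ⟨R, hR, hRd, hRq⟩ := exists_relation_of_degree_le (P := q.comap φ)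
    (Ideal.comap_mono bot_le) hdimφ hdeg ι
  exact ⟨R, hR, hRd, by rwa [Ideal.mem_comap, aeval_rename] at hRq⟩

attribute [local instance] Algebra.TensorProduct.rightAlgebra

variable {F : Type*} [Field F] {A : Type*} [CommRing A] [Algebra F A] {n : ℕ} {a : Fin n → A}

section

variable (K : Type*) [Field K] [Algebra F K]

theorem aeval_map_tensor (p : MvPolynomial (Fin n) F) :
    aeval (fun j => a j ⊗ₜ[F] (1 : K)) (map (algebraMap F K) p) = aeval a p ⊗ₜ[F] (1 : K) := by
  rw [aeval_map_algebraMap]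
  exact aeval_algebraMap_apply (A ⊗[F] K) a p

theorem surjective_aeval_tensor
    (ha : Function.Surjective (aeval a : MvPolynomial (Fin n) F →ₐ[F] A)) :
    Function.Surjective
      (aeval fun j => a j ⊗ₜ[F] (1 : K) : MvPolynomial (Fin n) K →ₐ[K] A ⊗[F] K) := by
  intro t
  induction t using TensorProduct.induction_on with
  | zero => exact ⟨0, map_zero _⟩
  | tmul b c =>
    obtain ⟨p, rfl⟩ := ha b
    refine ⟨C c * map (algebraMap F K) p, ?_⟩
    rw [map_mul, aeval_map_tensor, aeval_C, Algebra.TensorProduct.right_algebraMap_apply,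
      Algebra.TensorProduct.tmul_mul_tmul, one_mul, mul_one]
  | add t u ht hu =>
    obtain ⟨p, rfl⟩ := ht
    obtain ⟨p', rfl⟩ := hu
    exact ⟨p + p', map_add _ _ _⟩

theorem zeroLocus_ker_aeval_tensor
    (ha : Function.Surjective (aeval a : MvPolynomial (Fin n) F →ₐ[F] A)) :
    zeroLocus K (RingHom.ker
      (aeval fun j => a j ⊗ₜ[F] (1 : K) : MvPolynomial (Fin n) K →ₐ[K] A ⊗[F] K)) =
    zeroLocus K (RingHom.ker (aeval a : MvPolynomial (Fin n) F →ₐ[F] A)) := by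
  refine Set.Subset.antisymm (fun y hy p hp => ?_) fun y hy p hp => ?_
  · rw [← aeval_map_algebraMap K]
    refine hy _ ?_
    rw [RingHom.mem_ker, aeval_map_tensor, (RingHom.mem_ker).mp hp, TensorProduct.zero_tmul]
  · let φ : A →ₐ[F] K := AlgHom.liftOfSurjective (aeval a) ha (aeval y) hy
    have hφ (j : Fin n) : φ (a j) = y j := by
      simpa only [aeval_X] using AlgHom.liftOfSurjective_apply (aeval a) ha (aeval y) hy (X j)
    let ψ : A ⊗[F] K →ₐ[K] K :=
      (Algebra.TensorProduct.lift (AlgHom.id K K) φ fun _ _ => .all _ _).comp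
        (Algebra.TensorProduct.commRight F K A).symm
    have hψ (j : Fin n) : ψ (a j ⊗ₜ 1) = y j := by
      simp [ψ, hφ]
    have hψp := comp_aeval_apply (fun j => a j ⊗ₜ[F] (1 : K)) ψ p
    rw [(RingHom.mem_ker).mp hp, map_zero] at hψp
    simpa only [hψ] using hψp.symm

end

theorem isIntegral_generator {m k d : ℕ} (hkn : k ≤ n) {e : Fin n → ℕ} (he : ∀ j, d < e j)
    (hcop : Pairwise fun i j => Nat.Coprime (e i) (e j)) {M : Matrix (Fin m) (Fin n) F}
    (hM : IsRegularMatrix k M)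
    (ha : Function.Surjective (aeval a : MvPolynomial (Fin n) F →ₐ[F] A))
    (hdim : ringKrullDim A ≤ k)
    (hdeg : degreeOfIdeal (RingHom.ker (aeval a : MvPolynomial (Fin n) F →ₐ[F] A)) ≤ d)
    (j : Fin n) :
    IsIntegral (Algebra.adjoin F (Set.range fun i => aeval a (dklPoly M e i))) (a j) := by
  let S := Algebra.adjoin F (Set.range fun i => aeval a (dklPoly M e i))
  let K := AlgebraicClosure F
  let T := A ⊗[F] K
  have hdimT : ringKrullDim T ≤ k := (ringKrullDim_le_of_isIntegral (R := A)).trans hdim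
  suffices h : IsIntegral S (algebraMap A T (a j)) from
    (isIntegral_algebraMap_iff (FaithfulSMul.algebraMap_injective A T)).mp h
  refine isIntegral_of_forall_isPrime fun q hq => ?_
  let E := FractionRing (T ⧸ q)
  refine (isIntegral_algebraMap_iff (FaithfulSMul.algebraMap_injective (T ⧸ q) E)).mp ?_
  refine hM.isIntegral_of_relations (K := K) (x := fun j => algebraMap A E (a j)) hkn (fun c => ?_)
    he hcop (fun i => ?_) (fun ι _ => ?_) j
  · exact (Algebra.IsIntegral.isIntegral (R := F) c).algebraMap.tower_top
  · rw [show aeval (fun j => algebraMap A E (a j)) (dklPoly M e i) = _ from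
      aeval_algebraMap_apply E a _]
    exact isIntegral_algebraMap (R := S) (A := E)
      (x := ⟨_, Algebra.subset_adjoin (Set.mem_range_self i)⟩)
  · have hdegT := (congrArg degree (zeroLocus_ker_aeval_tensor K ha)).trans_le hdeg
    obtain ⟨R, hR, hRd, hRq⟩ := exists_relation_of_surjective_aeval
      (surjective_aeval_tensor K ha) hdimT hdegT q ι
    refine ⟨R, hR, hRd, (aeval_algebraMap_apply E (fun i => a (ι i) ⊗ₜ[F] (1 : K)) R).trans ?_⟩
    rw [IsScalarTower.algebraMap_apply T (T ⧸ q) E]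
    exact (congrArg _ (Ideal.Quotient.eq_zero_iff_mem.mpr hRq)).trans (map_zero _)

end BaseChange

end NoetherNorm

end

open MvPolynomial NoetherNorm in
theorem mainTheorem5 {F : Type*} [Field F] {A : Type*} [CommRing A] [Algebra F A]
    (n m k d : ℕ) (hm : 1 ≤ m) (hmn : m ≤ n) (hk : 1 ≤ k) (hkn : k ≤ n) (hd : 1 ≤ d)
    (e : Fin n → ℕ) (he : ∀ j, d < e j)
    (hcop : Pairwise fun i j => Nat.Coprime (e i) (e j))
    (M : Matrix (Fin m) (Fin n) F) (hM : NoetherNorm.IsRegularMatrix k M)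
    (a : Fin n → A) (hgen : Algebra.adjoin F (Set.range a) = ⊤)
    (hdim : ringKrullDim A ≤ k)
    (hdeg : NoetherNorm.degreeOfIdeal
      (RingHom.ker (MvPolynomial.aeval a : MvPolynomial (Fin n) F →ₐ[F] A)) ≤ d) :
    Module.Finite
      (Algebra.adjoin F (Set.range fun i => MvPolynomial.aeval a (NoetherNorm.dklPoly M e i))) A ∧
    (ringKrullDim A = k → k = m →
      AlgebraicIndependent F (fun i => MvPolynomial.aeval a (NoetherNorm.dklPoly M e i)) ∧
      ∃ Φ : Algebra.adjoin F
            (Set.range fun i => MvPolynomial.aeval a (NoetherNorm.dklPoly M e i)) ≃ₐ[F]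
          MvPolynomial (Fin m) F,
        ∀ i, Φ ⟨MvPolynomial.aeval a (NoetherNorm.dklPoly M e i),
          Algebra.subset_adjoin (Set.mem_range_self i)⟩ = MvPolynomial.X i) := by
  let f : Fin m → A := fun i => aeval a (dklPoly M e i)
  let S := Algebra.adjoin F (Set.range f)
  have hsurj : Function.Surjective (aeval a : MvPolynomial (Fin n) F →ₐ[F] A) := by
    rw [← AlgHom.range_eq_top, ← Algebra.adjoin_range_eq_range_aeval, hgen]
  have hint : Algebra.IsIntegral S A := by
    have : Algebra.IsIntegral (Algebra.adjoin F (Set.range a)) A :=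
      Algebra.isIntegral_of_surjective fun b => ⟨⟨b, hgen ▸ Algebra.mem_top⟩, rfl⟩
    exact isIntegral_of_adjoin (K := F) (s := Set.range a)
      (Set.forall_mem_range.mpr (isIntegral_generator hkn he hcop hM hsurj hdim hdeg))
  have : Algebra.FiniteType F A := .of_surjective _ hsurj
  have : Algebra.FiniteType S A := .of_restrictScalars_finiteType F S A
  refine ⟨Algebra.IsIntegral.finite, fun hdimk hkm => ?_⟩
  have hind : AlgebraicIndependent F f := by
    rw [algebraicIndependent_iff_card_le_ringKrullDim, Fintype.card_fin, hdimk, hkm]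
  refine ⟨hind, hind.aevalEquiv.symm, fun i => ?_⟩
  rw [AlgEquiv.symm_apply_eq]
  ext
  simp [f]
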